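/- Let $E$ be a complex Banach space with Banach dual $E'$, let $\mathcal B(E)$ be the algebra of bounded linear operators on $E$, and let $\mathcal A$ be a standard operator algebra on $E$, that is, a (not necessarily unital or closed) subalgebra of $\mathcal B(E)$ containing all bounded finite rank operators. For $T\in\mathcal B(E)$ let $T':E'\to E'$, $f\mapsto f\circ T$, be its dual operator. Fix $k\ge 2$ and a finite sequence $(i_1,\dots,i_m)$ with $\{i_1,\dots,i_m\}=\{1,\dots,k\}$ in which some index $i_p$ is different from all the other indices $i_q$ $(q\neq p)$. For $T_1,\dots,T_k\in\mathcal A$ define the generalized product and the generalized Jordan product $$T_1*\cdots*T_k=T_{i_1}\cdots T_{i_m},\qquad T_1\circ\cdots\circ T_k=T_{i_1}\cdots T_{i_m}+T_{i_m}\cdots T_{i_1}.$$ An algebra automorphism of $\mathcal A$ is a linear bijection $\theta:\mathcal A\to\mathcal A$ with $\theta(ab)=\theta(a)\theta(b)$ for all $a,b\in\mathcal A$; a linear Jordan automorphism of $\mathcal A$ is a linear bijection $\theta:\mathcal A\to\mathcal A$ with $\theta(ab+ba)=\theta(a)\theta(b)+\theta(b)\theta(a)$ for all $a,b\in\mathcal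 A$. **Theorem.** Let $\phi:\mathcal A\to\mathcal A$ be a map (not necessarily linear, additive or continuous), and suppose that one of the following holds. (a) The range $\phi(\mathcal A)$ contains all bounded operators on $E$ of rank at most two, and for any $a_1,\dots,a_k\in\mathcal A$, at least one of which has rank at most one, there is an algebra automorphism $\theta_{a_1,\dots,a_k}$ of $\mathcal A$ such that $$\phi(a_1)*\cdots*\phi(a_k)=\theta_{a_1,\dots,a_k}(a_1*\cdots*a_k).$$ (b) The range $\phi(\mathcal A)$ contains all bounded operators on $E$ of rank at most three, and for any $a_1,\dots,a_k\in\mathcal A$, at least one of which has rank at most one, there is a linear Jordan automorphism $\theta_{a_1,\dots,a_k}$ of $\mathcal A$ such that $$\phi(a_1)\circ\cdots\circ\phi(a_k)=\theta_{a_1,\dots,a_k}(a_1\circ\cdots\circ a_k).$$ Then there is a complex scalar $\xi$ with $\xi^m=1$ such that either $\phi(A)=\xi SAS^{-1}$ for all $A\in\mathcal A$, for some invertible bounded linear operator $S:E\to E$, or $\phi(A)=\xi SA'S^{-1}$ for all $A\in\mathcal A$, for some invertible bounded linear operator $S:E'\to E$. -/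

import Mathlib

namespace OpProd

section

variable {E : Type*} [NormedAddCommGroup E] [NormedSpace ℂ E]

/-- A standard operator algebra on `E`: a (not necessarily unital or closed) subalgebra of the
algebra `E →L[ℂ] E` of bounded operators that contains every bounded operator of finite rank. -/
def IsStandard (A : NonUnitalSubalgebra ℂ (E →L[ℂ] E)) : Prop :=
  ∀ T : E →L[ℂ] E, FiniteDimensional ℂ (LinearMap.range (T : E →ₗ[ℂ] E)) → T ∈ A

/-- `T` has rank at most `r`. -/
def RankLE (r : ℕ) (T : E →L[ℂ] E) : Prop :=
  LinearMap.rank (T : E →ₗ[ℂ] E) ≤ (r : Cardinal)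

/-- The Banach dual `T' : E' → E'` of a bounded operator, `f ↦ f ∘ T`. -/
noncomputable def dualOp (T : E →L[ℂ] E) : StrongDual ℂ E →L[ℂ] StrongDual ℂ E :=
  ContinuousLinearMap.precomp ℂ T

theorem dualOp_apply (T : E →L[ℂ] E) (f : StrongDual ℂ E) (x : E) : dualOp T f x = f (T x) :=
  rfl

/-- An algebra automorphism: a linear bijection that is multiplicative. -/
def IsAlgAut {A : NonUnitalSubalgebra ℂ (E →L[ℂ] E)} (θ : A ≃ₗ[ℂ] A) : Prop :=
  ∀ x y : A, θ (x * y) = θ x * θ y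

/-- A linear Jordan automorphism: a linear bijection that preserves the Jordan product. -/
def IsJordanAut {A : NonUnitalSubalgebra ℂ (E →L[ℂ] E)} (θ : A ≃ₗ[ℂ] A) : Prop :=
  ∀ x y : A, θ (x * y + y * x) = θ x * θ y + θ y * θ x

theorem list_prod_mem (A : NonUnitalSubalgebra ℂ (E →L[ℂ] E)) :
    ∀ l : List (E →L[ℂ] E), l ≠ [] → (∀ x ∈ l, x ∈ A) → l.prod ∈ A
  | [], h, _ => absurd rfl h
  | [x], _, hx => by simpa using hx
  | x :: y :: l, _, hx => by
      rw [List.prod_cons]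
      exact A.mul_mem (hx x (by simp))
        (list_prod_mem A (y :: l) (by simp) fun z hz => hx z (List.mem_cons_of_mem x hz))

end

/-- A finite sequence `(i₁, …, i_m)` with `{i₁, …, i_m} = {1, …, k}`, `k ≥ 2`, and an index `i_p`
that is different from all the other indices `i_q`. Indices are counted from `0`. -/
structure IndexSeq (m k : ℕ) where
  idx : Fin m → Fin k
  two_le : 2 ≤ k
  surj : Function.Surjective idx
  exists_single : ∃ p : Fin m, ∀ q : Fin m, q ≠ p → idx q ≠ idx p

theorem IndexSeq.pos {m k : ℕ} (s : IndexSeq m k) : 0 < m := by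
  obtain ⟨p, -⟩ := s.exists_single
  exact p.pos

section

variable {E : Type*} [NormedAddCommGroup E] [NormedSpace ℂ E]

/-- The ordered product `T 0 * T 1 * ⋯ * T (m - 1)` of `m ≥ 1` elements of `A`. -/
noncomputable def wordProd {A : NonUnitalSubalgebra ℂ (E →L[ℂ] E)} {m : ℕ} (hm : 0 < m)
    (T : Fin m → A) : A :=
  ⟨(List.ofFn fun j => (T j : E →L[ℂ] E)).prod, list_prod_mem A _
    (fun h => hm.ne' (List.ofFn_eq_nil_iff.mp h))
    (fun x hx => by
      obtain ⟨j, rfl⟩ := (List.mem_ofFn' _ _).mp hx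
      exact (T j).2)⟩

/-- The generalized product `T_{i₁} ⋯ T_{i_m}`. -/
noncomputable def genProd {A : NonUnitalSubalgebra ℂ (E →L[ℂ] E)} {m k : ℕ} (s : IndexSeq m k)
    (T : Fin k → A) : A :=
  wordProd s.pos fun j => T (s.idx j)

/-- The generalized Jordan product `T_{i₁} ⋯ T_{i_m} + T_{i_m} ⋯ T_{i₁}`. -/
noncomputable def genJordanProd {A : NonUnitalSubalgebra ℂ (E →L[ℂ] E)} {m k : ℕ}
    (s : IndexSeq m k) (T : Fin k → A) : A :=
  wordProd s.pos (fun j => T (s.idx j)) + wordProd s.pos (fun j => T (s.idx j.rev))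

/-- `φ` has the form `T ↦ ξ S T S⁻¹` with `ξ ^ m = 1` and `S : E → E` an invertible bounded
operator, or the form `T ↦ ξ S T' S⁻¹` with `ξ ^ m = 1` and `S : E' → E` an invertible bounded
operator. -/
def HasStandardForm (m : ℕ) {A : NonUnitalSubalgebra ℂ (E →L[ℂ] E)} (φ : A → A) : Prop :=
  ∃ ξ : ℂ, ξ ^ m = 1 ∧
    ((∃ S : E ≃L[ℂ] E, ∀ T : A,
        (φ T : E →L[ℂ] E) =
          ξ • ((S : E →L[ℂ] E) ∘L (T : E →L[ℂ] E) ∘L (S.symm : E →L[ℂ] E))) ∨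
      (∃ S : StrongDual ℂ E ≃L[ℂ] E, ∀ T : A,
        (φ T : E →L[ℂ] E) =
          ξ • ((S : StrongDual ℂ E →L[ℂ] E) ∘L dualOp (T : E →L[ℂ] E) ∘L
            (S.symm : E →L[ℂ] StrongDual ℂ E))))

end

end OpProd

/-! Put one operator `X` in the variable whose index occurs only once and one operator `B` in all
the others. Both products become `B ^ r * X * B ^ s + ε • (B ^ s * X * B ^ r)` with `r + s = m - 1`,
where `ε` is `0` or `1`. The automorphisms are unknown and vary with the arguments, but linear
Jordan automorphisms (hence algebra automorphisms) preserve rank bounds and traces of finite rank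
operators (`IsJordanAut.map_frle`).

Let `B = x ⊗ f` with `f x = 1` and `T = φ B`. Then `T ^ m` is a rank one idempotent, and a rank
bound on `T` forces `T ^ (m - 1)` to be of rank one, say `a ⊗ b`. Comparing traces gives `b (φ Y a)
= f (Y x)` for every `Y` (`exists_functional`).

This linearizes the problem: there is a bilinear `W` with `ftr (W x f * φ Y) = f (Y x)`, whose
values have rank at most one. Such maps have the form `S x ⊗ T f` or `S f ⊗ T x` (`exists_eq_rk`),
which yields the two alternatives. The trace of `W x f` is `c * f x` with `c ^ m = 1`, so `ξ = c⁻¹`,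
and `exists_intertwiner` turns `S` into a bounded isomorphism conjugating `φ` to the required form.
-/

namespace OpProd

/-! ### Rank one operators, and trace and rank of finite sums of them. -/

section FiniteRank

variable {E : Type*} [NormedAddCommGroup E] [NormedSpace ℂ E]

/-- The operator `y ↦ b y • a` of rank at most one. -/
noncomputable def rk (a : E) (b : StrongDual ℂ E) : E →L[ℂ] E := b.smulRight a

@[simp]
theorem rk_apply (a : E) (b : StrongDual ℂ E) (y : E) : rk a b y = b y • a := rfl

theorem mul_rk (T : E →L[ℂ] E) (a : E) (b : StrongDual ℂ E) : T * rk a b = rk (T a) b := by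
  ext y; simp

theorem rk_mul (T : E →L[ℂ] E) (a : E) (b : StrongDual ℂ E) : rk a b * T = rk a (b ∘L T) := rfl

theorem rk_add_left (a a' : E) (b : StrongDual ℂ E) : rk (a + a') b = rk a b + rk a' b := by
  ext y
  exact smul_add _ _ _

theorem rk_add_right (a : E) (b b' : StrongDual ℂ E) : rk a (b + b') = rk a b + rk a b' := by
  ext y
  exact add_smul _ _ _

theorem rk_smul_left (c : ℂ) (a : E) (b : StrongDual ℂ E) : rk (c • a) b = c • rk a b := by
  ext y
  exact smul_comm _ _ _

theorem rk_smul_right (c : ℂ) (a : E) (b : StrongDual ℂ E) : rk a (c • b) = c • rk a b := by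
  ext y; simp [mul_smul]

theorem rk_ne_zero {a : E} {b : StrongDual ℂ E} (ha : a ≠ 0) (hb : b ≠ 0) : rk a b ≠ 0 := by
  intro h
  apply hb
  ext y
  have := DFunLike.congr_fun h y
  simpa [ha] using this

theorem rk_mul_rk (a a' : E) (b b' : StrongDual ℂ E) : rk a b * rk a' b' = b a' • rk a b' := by
  ext y; simp [smul_smul, mul_comm]

theorem exists_dual_eq_one {x : E} (hx : x ≠ 0) : ∃ f : StrongDual ℂ E, f x = 1 :=
  SeparatingDual.exists_eq_one hx

theorem exists_apply_eq_one {f : StrongDual ℂ E} (hf : f ≠ 0) : ∃ x : E, f x = 1 := by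
  obtain ⟨x, hx⟩ := DFunLike.ne_iff.mp hf
  exact ⟨(f x)⁻¹ • x, by simpa using inv_mul_cancel₀ hx⟩

/-- The sum of the rank one operators listed in `l`. -/
noncomputable def opList (l : List (E × StrongDual ℂ E)) : E →L[ℂ] E :=
  (l.map fun p => rk p.1 p.2).sum

/-- The trace of `opList l`, computed termwise. -/
noncomputable def trList (l : List (E × StrongDual ℂ E)) : ℂ :=
  (l.map fun p => p.2 p.1).sum

@[simp] theorem opList_nil : opList ([] : List (E × StrongDual ℂ E)) = 0 := rfl
@[simp] theorem trList_nil : trList ([] : List (E × StrongDual ℂ E)) = 0 := rfl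

@[simp] theorem opList_cons (p : E × StrongDual ℂ E) (l) :
    opList (p :: l) = rk p.1 p.2 + opList l := by simp [opList]

@[simp] theorem trList_cons (p : E × StrongDual ℂ E) (l) :
    trList (p :: l) = p.2 p.1 + trList l := by simp [trList]

@[simp] theorem opList_append (l l' : List (E × StrongDual ℂ E)) :
    opList (l ++ l') = opList l + opList l' := by simp [opList]

@[simp] theorem trList_append (l l' : List (E × StrongDual ℂ E)) :
    trList (l ++ l') = trList l + trList l' := by simp [trList]

theorem opList_map_left (T : E →L[ℂ] E) (l : List (E × StrongDual ℂ E)) :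
    opList (l.map fun p => (T p.1, p.2)) = T * opList l := by
  induction l with
  | nil => simp
  | cons p l ih => simp [ih, mul_add, mul_rk]

theorem opList_map_right (T : E →L[ℂ] E) (l : List (E × StrongDual ℂ E)) :
    opList (l.map fun p => (p.1, p.2 ∘L T)) = opList l * T := by
  induction l with
  | nil => simp
  | cons p l ih => simp [ih, add_mul, rk_mul]

theorem trList_map (T : E →L[ℂ] E) (l : List (E × StrongDual ℂ E)) :
    trList (l.map fun p => (T p.1, p.2)) = trList (l.map fun p => (p.1, p.2 ∘L T)) := by
  induction l with
  | nil => simp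
  | cons p l ih => simp [ih]

theorem opList_map_smul (c : ℂ) (l : List (E × StrongDual ℂ E)) :
    opList (l.map fun p => (c • p.1, p.2)) = c • opList l := by
  induction l with
  | nil => simp
  | cons p l ih => simp [ih, rk_smul_left]

theorem trList_map_smul (c : ℂ) (l : List (E × StrongDual ℂ E)) :
    trList (l.map fun p => (c • p.1, p.2)) = c * trList l := by
  induction l with
  | nil => simp
  | cons p l ih => simp [ih, mul_add]

/-- The vectors of the list span a finite-dimensional `V`; restricted to `V`, the sum is the zero
endomorphism, and its ordinary trace is the termwise sum. Hence `ftr` does not depend on the chosen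
decomposition. -/
theorem trList_eq_zero {l : List (E × StrongDual ℂ E)} (h : opList l = 0) : trList l = 0 := by
  let V : Submodule ℂ E := Submodule.span ℂ (Set.range fun i : Fin l.length => (l.get i).1)
  have : FiniteDimensional ℂ V := FiniteDimensional.span_of_finite ℂ (Set.finite_range _)
  let a : Fin l.length → V := fun i => ⟨(l.get i).1, Submodule.subset_span ⟨i, rfl⟩⟩
  let b : Fin l.length → (V →ₗ[ℂ] ℂ) := fun i => ((l.get i).2 : E →ₗ[ℂ] ℂ) ∘ₗ V.subtype
  have h1 : opList l = ∑ i : Fin l.length, rk (l.get i).1 (l.get i).2 := by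
    rw [opList, ← List.sum_ofFn]
    congr 1
    conv_lhs => rw [← List.ofFn_get l]
    rw [List.map_ofFn]
    rfl
  have h2 : trList l = ∑ i : Fin l.length, (l.get i).2 (l.get i).1 := by
    rw [trList, ← List.sum_ofFn]
    congr 1
    conv_lhs => rw [← List.ofFn_get l]
    rw [List.map_ofFn]
    rfl
  have h3 : ∑ i, (b i).smulRight (a i) = 0 := by
    ext y
    have := DFunLike.congr_fun (h1.symm.trans h) (y : E)
    simpa [a, b, sum_apply] using this
  have h4 := congrArg (LinearMap.trace ℂ V) h3
  rw [map_sum] at h4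
  simp only [LinearMap.trace_smulRight, map_zero] at h4
  rw [h2]
  exact h4

/-- `T` is a finite sum of rank one operators. -/
def IsFR (T : E →L[ℂ] E) : Prop := ∃ l, opList l = T

theorem trList_congr {l l' : List (E × StrongDual ℂ E)} (h : opList l = opList l') :
    trList l = trList l' := by
  have := trList_eq_zero (l := l ++ l'.map fun p => ((-1 : ℂ) • p.1, p.2))
    (by rw [opList_append, opList_map_smul, h]; simp)
  rw [trList_append, trList_map_smul] at this
  linear_combination this

open Classical in
/-- The trace of a finite rank operator. -/
noncomputable def ftr (T : E →L[ℂ] E) : ℂ := if h : IsFR T then trList h.choose else 0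

theorem ftr_opList (l : List (E × StrongDual ℂ E)) : ftr (opList l) = trList l := by
  have h : IsFR (opList l) := ⟨l, rfl⟩
  rw [ftr, dif_pos h]
  exact trList_congr h.choose_spec

theorem IsFR.add {T T' : E →L[ℂ] E} (h : IsFR T) (h' : IsFR T') : IsFR (T + T') := by
  obtain ⟨l, rfl⟩ := h
  obtain ⟨l', rfl⟩ := h'
  exact ⟨l ++ l', by simp⟩

theorem IsFR.smul {T : E →L[ℂ] E} (h : IsFR T) (c : ℂ) : IsFR (c • T) := by
  obtain ⟨l, rfl⟩ := h
  exact ⟨_, opList_map_smul c l⟩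

theorem IsFR.mul_left {T : E →L[ℂ] E} (h : IsFR T) (S : E →L[ℂ] E) : IsFR (S * T) := by
  obtain ⟨l, rfl⟩ := h
  exact ⟨_, opList_map_left S l⟩

theorem IsFR.mul_right {T : E →L[ℂ] E} (h : IsFR T) (S : E →L[ℂ] E) : IsFR (T * S) := by
  obtain ⟨l, rfl⟩ := h
  exact ⟨_, opList_map_right S l⟩

theorem isFR_rk (a : E) (b : StrongDual ℂ E) : IsFR (rk a b) := ⟨[(a, b)], by simp⟩

theorem IsFR.pow {T : E →L[ℂ] E} (h : IsFR T) {n : ℕ} (hn : n ≠ 0) : IsFR (T ^ n) := by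
  obtain ⟨k, rfl⟩ := Nat.exists_eq_succ_of_ne_zero hn
  rw [pow_succ]
  exact h.mul_left _

theorem ftr_add {T T' : E →L[ℂ] E} (h : IsFR T) (h' : IsFR T') :
    ftr (T + T') = ftr T + ftr T' := by
  obtain ⟨l, rfl⟩ := h
  obtain ⟨l', rfl⟩ := h'
  rw [← opList_append]
  simp only [ftr_opList, trList_append]

theorem ftr_smul {T : E →L[ℂ] E} (h : IsFR T) (c : ℂ) : ftr (c • T) = c * ftr T := by
  obtain ⟨l, rfl⟩ := h
  rw [← opList_map_smul, ftr_opList, ftr_opList, trList_map_smul]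

theorem ftr_rk (a : E) (b : StrongDual ℂ E) : ftr (rk a b) = b a := by
  have := ftr_opList [(a, b)]
  simpa using this

theorem ftr_mul_comm {T : E →L[ℂ] E} (h : IsFR T) (S : E →L[ℂ] E) :
    ftr (S * T) = ftr (T * S) := by
  obtain ⟨l, rfl⟩ := h
  rw [← opList_map_left, ← opList_map_right, ftr_opList, ftr_opList, trList_map]

/-- `T` is a sum of at most `d` rank one operators. -/
def FRLE (d : ℕ) (T : E →L[ℂ] E) : Prop := ∃ l, l.length ≤ d ∧ opList l = T

theorem FRLE.isFR {d : ℕ} {T : E →L[ℂ] E} (h : FRLE d T) : IsFR T := ⟨_, h.choose_spec.2⟩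

theorem FRLE.mul_left {d : ℕ} {T : E →L[ℂ] E} (h : FRLE d T) (S : E →L[ℂ] E) :
    FRLE d (S * T) := by
  obtain ⟨l, hl, rfl⟩ := h
  exact ⟨_, by simpa using hl, opList_map_left S l⟩

theorem FRLE.mul_right {d : ℕ} {T : E →L[ℂ] E} (h : FRLE d T) (S : E →L[ℂ] E) :
    FRLE d (T * S) := by
  obtain ⟨l, hl, rfl⟩ := h
  exact ⟨_, by simpa using hl, opList_map_right S l⟩

theorem FRLE.smul {d : ℕ} {T : E →L[ℂ] E} (h : FRLE d T) (c : ℂ) : FRLE d (c • T) := by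
  obtain ⟨l, hl, rfl⟩ := h
  exact ⟨_, by simpa using hl, opList_map_smul c l⟩

theorem FRLE.add {d d' : ℕ} {T T' : E →L[ℂ] E} (h : FRLE d T) (h' : FRLE d' T') :
    FRLE (d + d') (T + T') := by
  obtain ⟨l, hl, rfl⟩ := h
  obtain ⟨l', hl', rfl⟩ := h'
  exact ⟨l ++ l', by simpa using add_le_add hl hl', by simp⟩

theorem frle_rk (a : E) (b : StrongDual ℂ E) : FRLE 1 (rk a b) := ⟨[(a, b)], by simp⟩

theorem FRLE.mono {d d' : ℕ} {T : E →L[ℂ] E} (h : FRLE d T) (hd : d ≤ d') : FRLE d' T := by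
  obtain ⟨l, hl, rfl⟩ := h
  exact ⟨l, hl.trans hd, rfl⟩

theorem FRLE.exists_rk {T : E →L[ℂ] E} (h : FRLE 1 T) : ∃ a b, T = rk a b := by
  obtain ⟨l, hl, rfl⟩ := h
  match l, hl with
  | [], _ => exact ⟨0, 0, by ext; simp⟩
  | [p], _ => exact ⟨p.1, p.2, by simp⟩

theorem rank_opList_le (l : List (E × StrongDual ℂ E)) :
    LinearMap.rank (opList l : E →ₗ[ℂ] E) ≤ (l.length : Cardinal) := by
  induction l with
  | nil => simp
  | cons p l ih =>
    have h1 : LinearMap.rank (rk p.1 p.2 : E →ₗ[ℂ] E) ≤ 1 := by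
      refine (rank_submodule_le_one_iff' _).mpr ⟨p.1, ?_⟩
      rintro _ ⟨y, rfl⟩
      exact Submodule.mem_span_singleton.mpr ⟨p.2 y, rfl⟩
    rw [opList_cons, ContinuousLinearMap.toLinearMap_add, List.length_cons, Nat.cast_succ, add_comm _ 1]
    exact (LinearMap.rank_add_le _ _).trans (add_le_add h1 ih)

theorem FRLE.rankLE {d : ℕ} {T : E →L[ℂ] E} (h : FRLE d T) : RankLE d T := by
  obtain ⟨l, hl, rfl⟩ := h
  exact (rank_opList_le l).trans (by exact_mod_cast hl)

theorem IsStandard.mem {A : NonUnitalSubalgebra ℂ (E →L[ℂ] E)} (hA : IsStandard A)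
    {T : E →L[ℂ] E} (h : IsFR T) : T ∈ A := by
  obtain ⟨l, rfl⟩ := h
  apply hA
  exact Module.rank_lt_aleph0_iff.mp ((rank_opList_le l).trans_lt (Cardinal.natCast_lt_aleph0))

theorem FRLE.card_le {d n : ℕ} {T : E →L[ℂ] E} (h : FRLE d T) {v : Fin n → E}
    (hv : LinearIndependent ℂ fun i => T (v i)) : n ≤ d := by
  have h1 : (n : Cardinal) ≤ LinearMap.rank (T : E →ₗ[ℂ] E) := by
    refine Module.le_rank_iff.mpr
      ⟨fun i => ⟨T (v i), v i, rfl⟩, LinearIndependent.of_comp (Submodule.subtype _) hv⟩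
  have := h1.trans h.rankLE
  exact_mod_cast this

theorem frle_of_forall {d : ℕ} {T : E →L[ℂ] E}
    (h : ∀ v : Fin (d + 1) → E, ¬ LinearIndependent ℂ fun i => T (v i)) : FRLE d T := by
  have h1 : Module.rank ℂ (LinearMap.range (T : E →ₗ[ℂ] E)) < ((d + 1 : ℕ) : Cardinal) := by
    by_contra hc
    obtain ⟨w, hw⟩ := Module.le_rank_iff.mp (not_lt.mp hc)
    choose v hv using fun i => (w i).2
    refine h v ?_
    have := hw.map' (Submodule.subtype _) (Submodule.ker_subtype _)
    have hv' : (fun i => T (v i)) = (LinearMap.range (T : E →ₗ[ℂ] E)).subtype ∘ w := funext hv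
    rw [hv']
    exact this
  have hfin : FiniteDimensional ℂ (LinearMap.range (T : E →ₗ[ℂ] E)) :=
    Module.rank_lt_aleph0_iff.mp (h1.trans Cardinal.natCast_lt_aleph0)
  have h2 : Module.finrank ℂ (LinearMap.range (T : E →ₗ[ℂ] E)) ≤ d := by
    rw [← Module.finrank_eq_rank] at h1
    exact Nat.lt_succ_iff.mp (by exact_mod_cast h1)
  let w := Module.finBasis ℂ (LinearMap.range (T : E →ₗ[ℂ] E))
  let T' : E →L[ℂ] LinearMap.range (T : E →ₗ[ℂ] E) := T.codRestrict _ fun x => ⟨x, rfl⟩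
  refine ⟨List.ofFn fun i => ((w i : E), (LinearMap.toContinuousLinearMap (w.coord i)) ∘L T'),
    by simpa using h2, ?_⟩
  ext y
  have h3 := congrArg Subtype.val (w.sum_repr (T' y))
  rw [opList, List.map_ofFn, List.sum_ofFn]
  simp only [Submodule.coe_sum, Submodule.coe_smul] at h3
  rw [sum_apply]
  exact h3

end FiniteRank

/-! ### Detecting rank by compressions to finite-dimensional subspaces. -/

section Compression

variable {E : Type*} [NormedAddCommGroup E] [NormedSpace ℂ E]

theorem exists_dual_family {n : ℕ} {v : Fin n → E} (hv : LinearIndependent ℂ v) :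
    ∃ f : Fin n → StrongDual ℂ E, ∀ i j, f i (v j) = (1 : Matrix (Fin n) (Fin n) ℂ) i j := by
  have h := (SeparatingDual.dualMap_surjective_iff (R := ℂ)
    (f := Fintype.linearCombination ℂ v)).mpr
      (linearIndependent_iff_injective_fintypeLinearCombination.mp hv)
  choose f hf using fun i => h (LinearMap.proj i)
  refine ⟨f, fun i j => ?_⟩
  have := LinearMap.congr_fun (hf i) (Pi.single j 1)
  simpa [Fintype.linearCombination_apply_single, Matrix.one_apply, Pi.single_apply] using this

theorem linearIndependent_of_det_ne_zero {n : ℕ} {w : Fin n → E} (k : Fin n → StrongDual ℂ E)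
    (h : (Matrix.of fun i j => k i (w j)).det ≠ 0) : LinearIndependent ℂ w := by
  rw [Fintype.linearIndependent_iff]
  intro g hg
  refine congrFun (Matrix.eq_zero_of_mulVec_eq_zero h ?_)
  ext i
  have := congrArg (k i) hg
  simpa [Matrix.mulVec, dotProduct, mul_comm] using this

/-- As polynomials in `t`, the first determinant has constant term 1 and the second is monic, so
their product is not the zero polynomial. -/
theorem exists_det_ne_zero {n : ℕ} (M N : Matrix (Fin n) (Fin n) ℂ) :
    ∃ t : ℂ, (1 + t • M).det ≠ 0 ∧ (N + t • 1).det ≠ 0 := by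
  have h1 : (-M).charpolyRev ≠ 0 := fun h => by
    have := Matrix.eval_charpolyRev (M := -M)
    simp [h] at this
  have h2 := ((-N).charpoly_monic).ne_zero
  by_contra! hc
  refine mul_ne_zero h1 h2 (Polynomial.funext fun t => ?_)
  rw [Polynomial.eval_mul, Polynomial.eval_zero, mul_eq_zero, or_iff_not_imp_left]
  intro h3
  rw [Matrix.eval_charpoly]
  convert hc t ?_ using 2
  · simp [add_comm, Matrix.smul_one_eq_diagonal]
  · convert h3 using 1
    rw [Matrix.charpolyRev, ← Polynomial.coe_evalRingHom, RingHom.map_det]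
    congr 1
    ext i j
    by_cases h : i = j <;> simp [h, mul_comm t]

/-- If all compressions of `T` to subspaces of dimension `d + 1` are of rank at most `d`, then so
is `T`. -/
theorem frle_of_compression {d : ℕ} {T : E →L[ℂ] E}
    (h : ∀ R : E →L[ℂ] E, R * R = R → FRLE (d + 1) R → FRLE d (R * T * R)) : FRLE d T := by
  refine frle_of_forall fun v hv => ?_
  have hv' : LinearIndependent ℂ v := LinearIndependent.of_comp (T : E →ₗ[ℂ] E) hv
  obtain ⟨f, hf⟩ := exists_dual_family hv'
  obtain ⟨f', hf'⟩ := exists_dual_family hv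
  obtain ⟨t, h1, h2⟩ := exists_det_ne_zero (Matrix.of fun i j => f' i (v j))
    (Matrix.of fun i j => f i (T (v j)))
  set H := 1 + t • (Matrix.of fun i j => f' i (v j)) with hH
  set K := (Matrix.of fun i j => f i (T (v j))) + t • (1 : Matrix (Fin (d + 1)) (Fin (d + 1)) ℂ)
    with hK
  -- The functionals `f + t f'` have matrix `H` on the `v j` and `K` on the `T (v j)`. Normalizing
  -- by `H⁻¹` makes `k` dual to `v`, so `R = ∑ v i ⊗ k i` is idempotent and `R * T * R` has the
  -- invertible matrix `H⁻¹ * K`.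
  let k : Fin (d + 1) → StrongDual ℂ E := fun i => ∑ l, H⁻¹ i l • (f l + t • f' l)
  have hk1 : ∀ i j, k i (v j) = (1 : Matrix (Fin (d + 1)) (Fin (d + 1)) ℂ) i j := by
    intro i j
    rw [← Matrix.nonsing_inv_mul H (isUnit_iff_ne_zero.mpr h1), Matrix.mul_apply]
    simp [k, sum_apply, hH, hf, mul_add]
  have hk2 : ∀ i j, k i (T (v j)) = (H⁻¹ * K) i j := by
    intro i j
    rw [Matrix.mul_apply]
    simp [k, sum_apply, hK, hf', mul_add]
  let R : E →L[ℂ] E := opList (List.ofFn fun i => (v i, k i))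
  have hR : ∀ y, R y = ∑ i, k i y • v i := by
    intro y
    simp only [R, opList, List.map_ofFn, List.sum_ofFn, sum_apply]
    rfl
  have hRv : ∀ j, R (v j) = v j := by
    intro j
    simp [hR, hk1, Matrix.one_apply]
  have hkR : ∀ i y, k i (R y) = k i y := by
    intro i y
    simp [hR, hk1, Matrix.one_apply]
  have hRR : R * R = R := by
    ext y
    rw [mul_apply_eq_comp]
    conv_lhs => rw [hR]
    rw [hR]
    simp only [← hR y, hkR]
  have h3 := h R hRR ⟨_, by simp, rfl⟩
  have h4 : LinearIndependent ℂ fun j => (R * T * R) (v j) := by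
    refine linearIndependent_of_det_ne_zero k ?_
    have : (Matrix.of fun i j => k i ((R * T * R) (v j))) = H⁻¹ * K := by
      ext i j
      simp [hRv, hkR, hk2]
    rw [this, Matrix.det_mul]
    exact mul_ne_zero (by simpa using h1) h2
  exact absurd (h3.card_le h4) (by simp)

end Compression

/-! ### Bilinear maps into the operators of rank at most one. -/

section Minors

variable {E : Type*} [NormedAddCommGroup E] [NormedSpace ℂ E]

/-- All `2 × 2` minors of `M` vanish. -/
def Minors (M : E →L[ℂ] E) : Prop :=
  ∀ (g g' : StrongDual ℂ E) (y y' : E), g (M y) * g' (M y') = g (M y') * g' (M y)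

theorem minors_rk (a : E) (b : StrongDual ℂ E) : Minors (rk a b) := by
  intro g g' y y'
  simp
  ring

theorem Minors.exists_rk {M : E →L[ℂ] E} (h : Minors M) : ∃ a b, M = rk a b := by
  by_cases h0 : M = 0
  · exact ⟨0, 0, by ext; simp [h0]⟩
  obtain ⟨y', hy'⟩ := DFunLike.ne_iff.mp h0
  obtain ⟨g', hg'⟩ := exists_dual_eq_one hy'
  refine ⟨M y', g' ∘L M, ?_⟩
  ext y
  refine (SeparatingDual.eq_iff_forall_dual_eq (R := ℂ)).mpr fun g => ?_
  have := h g g' y y'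
  rw [hg'] at this
  simp
  linear_combination this

/-- The polarization of the `2 × 2` minors. -/
noncomputable def bracket (M N : E →L[ℂ] E) (g g' : StrongDual ℂ E) (y y' : E) : ℂ :=
  g (M y) * g' (N y') + g (N y) * g' (M y') - g (M y') * g' (N y) - g (N y') * g' (M y)

theorem bracket_eq_zero {M N : E →L[ℂ] E} (hM : Minors M) (hN : Minors N) (hMN : Minors (M + N))
    (g g' : StrongDual ℂ E) (y y' : E) : bracket M N g g' y y' = 0 := by
  have h1 := hM g g' y y'
  have h2 := hN g g' y y'
  have h3 := hMN g g' y y'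
  simp only [add_apply, map_add] at h3
  rw [bracket]
  linear_combination h3 - h1 - h2

theorem bracket_rk (a a' : E) (b b' : StrongDual ℂ E) (g g' : StrongDual ℂ E) (y y' : E) :
    bracket (rk a b) (rk a' b') g g' y y' =
      (g a * g' a' - g a' * g' a) * (b y * b' y' - b y' * b' y) := by
  simp [bracket]
  ring

theorem eq_rk_of_forall {a a' : E} {b b' : StrongDual ℂ E}
    (h : ∀ (g : StrongDual ℂ E) (y : E), g a * b y = g a' * b' y) : rk a b = rk a' b' := by
  ext y
  refine (SeparatingDual.eq_iff_forall_dual_eq (R := ℂ)).mpr fun g => ?_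
  have := h g y
  simp
  linear_combination this

theorem mul_rk_eq_iff {u : E} {v : StrongDual ℂ E} {M : E →L[ℂ] E} :
    M * rk u v = M ↔ M = rk (M u) v := by
  rw [mul_rk]
  exact eq_comm

/-- If `a ⊗ b` is orthogonal to the idempotent `u ⊗ v`, they have the same range or kernel. -/
theorem absorb_of_bracket {u a : E} {v b : StrongDual ℂ E} (hvu : v u = 1)
    (h : ∀ g g' y y', bracket (rk a b) (rk u v) g g' y y' = 0) :
    (∀ g : StrongDual ℂ E, g a = g u * v a) ∨ ∀ y, b y = b u * v y := by
  by_contra! hc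
  obtain ⟨⟨g, hg⟩, y, hy⟩ := hc
  have h1 := h g v y u
  rw [bracket_rk, hvu] at h1
  rcases mul_eq_zero.mp h1 with h1 | h1
  · exact hg (by linear_combination h1)
  · exact hy (by linear_combination h1)

theorem absorb_or {u : E} {v : StrongDual ℂ E} (hvu : v u = 1) {M : E →L[ℂ] E} (hM : Minors M)
    (hMP : Minors (M + rk u v)) : rk u v * M = M ∨ M * rk u v = M := by
  have h := bracket_eq_zero hM (minors_rk u v) hMP
  obtain ⟨a, b, rfl⟩ := hM.exists_rk
  rcases absorb_of_bracket hvu h with h | h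
  · left
    rw [rk_mul_rk, ← rk_smul_left]
    refine eq_rk_of_forall fun g y => ?_
    rw [h g]
    simp [mul_comm]
  · right
    rw [rk_mul_rk, ← rk_smul_left]
    refine eq_rk_of_forall fun g y => ?_
    rw [h y]
    simp
    ring

variable {X Y : Type*} [AddCommGroup X] [Module ℂ X] [AddCommGroup Y] [Module ℂ Y]

/-- A vector space is not the union of two proper subspaces. -/
theorem absorb_uniform {P : E →L[ℂ] E} (G : X →ₗ[ℂ] E →L[ℂ] E)
    (h : ∀ x, P * G x = G x ∨ G x * P = G x) :
    (∀ x, P * G x = G x) ∨ ∀ x, G x * P = G x := by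
  by_contra! hc
  obtain ⟨⟨x, hx⟩, x', hx'⟩ := hc
  have h1 := (h x).resolve_left hx
  have h2 := (h x').resolve_right hx'
  rcases h (x + x') with h3 | h3
  · rw [map_add, mul_add, h2] at h3
    exact hx (add_right_cancel h3)
  · rw [map_add, add_mul, h1] at h3
    exact hx' (add_left_cancel h3)

variable {F : X →ₗ[ℂ] Y →ₗ[ℂ] E →L[ℂ] E}

theorem bracket_left (hF : ∀ x f, Minors (F x f)) (x x' : X) (f : Y)
    (g g' : StrongDual ℂ E) (y y' : E) : bracket (F x f) (F x' f) g g' y y' = 0 :=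
  bracket_eq_zero (hF _ _) (hF _ _) (by simpa using hF (x + x') f) g g' y y'

theorem bracket_right (hF : ∀ x f, Minors (F x f)) (x : X) (f f' : Y)
    (g g' : StrongDual ℂ E) (y y' : E) : bracket (F x f) (F x f') g g' y y' = 0 :=
  bracket_eq_zero (hF _ _) (hF _ _) (by simpa using hF x (f + f')) g g' y y'

/-- A second polarization, in the other argument; it ties a general value of `F` to the values along
two axes. -/
theorem bracket_cross (hF : ∀ x f, Minors (F x f)) (x x' : X) (f f' : Y)
    (g g' : StrongDual ℂ E) (y y' : E) :
    bracket (F x f) (F x' f') g g' y y' + bracket (F x' f) (F x f') g g' y y' = 0 := by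
  have h1 := bracket_left hF x x' f g g' y y'
  have h2 := bracket_left hF x x' f' g g' y y'
  have h3 := bracket_left hF x x' (f + f') g g' y y'
  simp only [bracket, map_add, add_apply] at h1 h2 h3 ⊢
  linear_combination h3 - h1 - h2

/-- Subtracting multiples of the base point moves both arguments into the kernels of `p` and `q`. -/
theorem eq_of_base {Z : Type*} [AddCommGroup Z] [Module ℂ Z] {G : X →ₗ[ℂ] Y →ₗ[ℂ] Z}
    {e : X} {e₀ : Y} (p : X →ₗ[ℂ] ℂ) (q : Y →ₗ[ℂ] ℂ) (hp : p e = 1) (hq : q e₀ = 1)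
    (h1 : ∀ x, G x e₀ = 0) (h2 : ∀ f, G e f = 0)
    (h3 : ∀ x f, p x = 0 → q f = 0 → G x f = 0) (x : X) (f : Y) : G x f = 0 := by
  have h := h3 (x - p x • e) (f - q f • e₀) (by simp [hp]) (by simp [hq])
  simpa [h1, h2] using h

/-- A bilinear map into rank one operators that is a product along both axes through a base point
is a product. -/
theorem eq_rk_of_axes (hF : ∀ x f, Minors (F x f)) (hne : ∀ x f, F x f = 0 → x = 0 ∨ f = 0)
    {e : X} {e₀ : Y} {u : E} {v : StrongDual ℂ E} (he : F e e₀ = rk u v) (hvu : v u = 1)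
    (S : X →ₗ[ℂ] E) (T : Y →ₗ[ℂ] StrongDual ℂ E)
    (hS : ∀ x, F x e₀ = rk (S x) v) (hT : ∀ f, F e f = rk u (T f)) (x : X) (f : Y) :
    F x f = rk (S x) (T f) := by
  have hu : u ≠ 0 := fun h => by simp [h] at hvu
  have hv : v ≠ 0 := fun h => by simp [h] at hvu
  have he0 : F e e₀ ≠ 0 := he ▸ rk_ne_zero hu hv
  have he1 : e ≠ 0 := fun h => he0 (by simp [h])
  have he2 : e₀ ≠ 0 := fun h => he0 (by simp [h])
  have hSe : S e = u := by
    have := DFunLike.congr_fun ((hS e).symm.trans he) u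
    simpa [hvu] using this
  have hTe : T e₀ = v := by
    ext y
    have := congrArg v (DFunLike.congr_fun ((hT e₀).symm.trans he) y)
    simpa [hvu] using this
  let B : X →ₗ[ℂ] Y →ₗ[ℂ] E →L[ℂ] E := LinearMap.mk₂ ℂ (fun x f => rk (S x) (T f))
    (fun _ _ _ => by rw [map_add, rk_add_left]) (fun _ _ _ => by rw [map_smul, rk_smul_left])
    (fun _ _ _ => by rw [map_add, rk_add_right]) (fun _ _ _ => by rw [map_smul, rk_smul_right])
  refine sub_eq_zero.mp (eq_of_base (G := F - B) (e := e) (e₀ := e₀) ((v : E →ₗ[ℂ] ℂ) ∘ₗ S)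
    ((ContinuousLinearMap.apply ℂ ℂ u : StrongDual ℂ E →ₗ[ℂ] ℂ) ∘ₗ T)
    (by simp [hSe, hvu]) (by simp [hTe, hvu]) (fun x => ?_) (fun f => ?_) (fun x f h1 h2 => ?_) x f)
  · simp [B, hS, hTe]
  · simp [B, hT, hSe]
  replace h1 : v (S x) = 0 := h1
  replace h2 : T f u = 0 := h2
  change F x f - rk (S x) (T f) = 0
  rw [sub_eq_zero]
  by_cases hSx : S x = 0
  · have : x = 0 := (hne x e₀ (by rw [hS, hSx]; ext; simp)).resolve_right he2
    ext; simp [this]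
  by_cases hTf : T f = 0
  · have : f = 0 := (hne e f (by rw [hT, hTf]; ext; simp)).resolve_left he1
    ext; simp [this]
  obtain ⟨g₁, hg₁⟩ := exists_dual_eq_one hSx
  obtain ⟨y₁, hy₁⟩ := exists_apply_eq_one hTf
  have b1 := bracket_left hF x e f
  have b2 := bracket_right hF x f e₀
  have b3 := bracket_cross hF x e f e₀
  rw [hT] at b1
  rw [hS] at b2
  rw [he, hT, hS] at b3
  obtain ⟨a, b, hab⟩ := (hF x f).exists_rk
  rw [hab] at b1 b2 b3 ⊢
  simp only [bracket_rk] at b1 b2 b3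
  -- The cross relation at `g' = v`, `y' = u`: up to the corrections `v a` and `b u`, it says `a ⊗ b
  -- = S x ⊗ T f`. The brackets along the axes then show that both corrections vanish.
  have key : ∀ (g : StrongDual ℂ E) (y : E),
      (g a - g u * v a) * (b y - b u * v y) = g (S x) * T f y := by
    intro g y
    have := b3 g v y u
    rw [hvu, h1, h2] at this
    linear_combination this
  have k1 := key g₁ y₁
  rw [hg₁, hy₁, mul_one] at k1
  have hbu : b u = 0 := by
    have := b1 g₁ v y₁ u
    rw [hvu, h2, hy₁] at this
    have h3 : g₁ a - g₁ u * v a ≠ 0 := left_ne_zero_of_mul_eq_one k1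
    exact (mul_eq_zero.mp (show (g₁ a - g₁ u * v a) * b u = 0 by
      linear_combination -this)).resolve_left h3
  have hva : v a = 0 := by
    have := b2 g₁ v y₁ u
    rw [hvu, h1, hg₁] at this
    have h3 : b y₁ - b u * v y₁ ≠ 0 := right_ne_zero_of_mul_eq_one k1
    exact (mul_eq_zero.mp (show v a * (b y₁ - b u * v y₁) = 0 by
      linear_combination -this)).resolve_right h3
  refine eq_rk_of_forall fun g y => ?_
  have := key g y
  rw [hbu, hva] at this
  linear_combination this

/-- When both axes share the functional `v`, one half of the cross relation vanishes, so `F x f`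
shares its kernel or its range with `u ⊗ v`. In the second case, comparison with `F x e₀` forces `F
x f = 0`. -/
theorem absorb_right_of_axes (hF : ∀ x f, Minors (F x f)) (hne : ∀ x f, F x f = 0 → x = 0 ∨ f = 0)
    {e : X} {e₀ : Y} {u : E} {v : StrongDual ℂ E} (he : F e e₀ = rk u v) (hvu : v u = 1)
    (hS : ∀ x, F x e₀ * rk u v = F x e₀) (hT : ∀ f, F e f * rk u v = F e f) (x : X) (f : Y) :
    F x f * rk u v = F x f := by
  have hu : u ≠ 0 := fun h => by simp [h] at hvu
  have hv : v ≠ 0 := fun h => by simp [h] at hvu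
  have he0 : F e e₀ ≠ 0 := he ▸ rk_ne_zero hu hv
  have he2 : e₀ ≠ 0 := fun h => he0 (by simp [h])
  let B : X →ₗ[ℂ] Y →ₗ[ℂ] E →L[ℂ] E :=
    F.compr₂ (LinearMap.mulRight ℂ (rk u v))
  have hB : ∀ x f, B x f = F x f * rk u v := fun _ _ => rfl
  let p : (E →L[ℂ] E) →ₗ[ℂ] ℂ := (v : E →ₗ[ℂ] ℂ) ∘ₗ (ContinuousLinearMap.apply ℂ E u)
  have hp : ∀ M, p M = v (M u) := fun _ => rfl
  refine sub_eq_zero.mp (eq_of_base (G := B - F) (e := e) (e₀ := e₀) (p ∘ₗ F.flip e₀)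
    (p ∘ₗ F e) (by simp [hp, he, hvu]) (by simp [hp, he, hvu]) (fun x => ?_) (fun f => ?_)
    (fun x f h1 h2 => ?_) x f)
  · simp [hB, hS]
  · simp [hB, hT]
  replace h1 : v (F x e₀ u) = 0 := h1
  change F x f * rk u v - F x f = 0
  rw [sub_eq_zero]
  by_cases hSx : F x e₀ u = 0
  · have : x = 0 := (hne x e₀ (by rw [← hS, mul_rk, hSx]; ext; simp)).resolve_right he2
    simp [this]
  obtain ⟨g₁, hg₁⟩ := exists_dual_eq_one hSx
  have b2 := bracket_right hF x f e₀
  have b3 := bracket_cross hF x e f e₀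
  rw [mul_rk_eq_iff.mp (hS x)] at b2
  rw [mul_rk_eq_iff.mp (hT f), mul_rk_eq_iff.mp (hS x), he] at b3
  obtain ⟨a, b, hab⟩ := (hF x f).exists_rk
  rw [hab] at b2 b3 ⊢
  have h4 : ∀ g g' y y', bracket (rk a b) (rk u v) g g' y y' = 0 := by
    intro g g' y y'
    have := b3 g g' y y'
    rw [bracket_rk (F e f u)] at this
    linear_combination this
  rw [rk_mul_rk, ← rk_smul_right]
  by_cases h5 : ∀ y, b y = b u * v y
  · congr 1
    ext y
    simp [h5 y]
  have h6 := (absorb_of_bracket hvu h4).resolve_right h5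
  push Not at h5
  obtain ⟨y, hy⟩ := h5
  have h7 := b2 g₁ v y u
  rw [bracket_rk, hg₁, h1, hvu] at h7
  have h8 : v a = 0 := (mul_eq_zero.mp (show v a * (b y - b u * v y) = 0 by
    linear_combination -h7)).resolve_right (sub_ne_zero.mpr hy)
  have h9 : a = 0 := SeparatingDual.eq_zero_of_forall_dual_eq_zero (R := ℂ)
    fun g => by rw [h6 g, h8, mul_zero]
  ext; simp [h9]

theorem absorb_left_of_axes (hF : ∀ x f, Minors (F x f)) (hne : ∀ x f, F x f = 0 → x = 0 ∨ f = 0)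
    {e : X} {e₀ : Y} {u : E} {v : StrongDual ℂ E} (he : F e e₀ = rk u v) (hvu : v u = 1)
    (hS : ∀ x, rk u v * F x e₀ = F x e₀) (hT : ∀ f, rk u v * F e f = F e f) (x : X) (f : Y) :
    rk u v * F x f = F x f := by
  have hu : u ≠ 0 := fun h => by simp [h] at hvu
  have hv : v ≠ 0 := fun h => by simp [h] at hvu
  have he0 : F e e₀ ≠ 0 := he ▸ rk_ne_zero hu hv
  have he2 : e₀ ≠ 0 := fun h => he0 (by simp [h])
  let B : X →ₗ[ℂ] Y →ₗ[ℂ] E →L[ℂ] E :=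
    F.compr₂ (LinearMap.mulLeft ℂ (rk u v))
  have hB : ∀ x f, B x f = rk u v * F x f := fun _ _ => rfl
  let p : (E →L[ℂ] E) →ₗ[ℂ] ℂ := (v : E →ₗ[ℂ] ℂ) ∘ₗ (ContinuousLinearMap.apply ℂ E u)
  have hp : ∀ M, p M = v (M u) := fun _ => rfl
  refine sub_eq_zero.mp (eq_of_base (G := B - F) (e := e) (e₀ := e₀) (p ∘ₗ F.flip e₀)
    (p ∘ₗ F e) (by simp [hp, he, hvu]) (by simp [hp, he, hvu]) (fun x => ?_) (fun f => ?_)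
    (fun x f h1 h2 => ?_) x f)
  · simp [hB, hS]
  · simp [hB, hT]
  replace h1 : v (F x e₀ u) = 0 := h1
  change rk u v * F x f - F x f = 0
  rw [sub_eq_zero]
  by_cases hSx : F x e₀ = 0
  · simp [(hne x e₀ hSx).resolve_right he2]
  have hSx' : v ∘L F x e₀ ≠ 0 := fun h => hSx (by
    rw [← hS, rk_mul, h]; ext; simp)
  obtain ⟨y₁, hy₁⟩ := exists_apply_eq_one hSx'
  have b2 := bracket_right hF x f e₀
  have b3 := bracket_cross hF x e f e₀
  rw [← hS, rk_mul] at b2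
  rw [← hT f, ← hS x, rk_mul, rk_mul, he] at b3
  obtain ⟨a, b, hab⟩ := (hF x f).exists_rk
  rw [hab] at b2 b3 ⊢
  have h4 : ∀ g g' y y', bracket (rk a b) (rk u v) g g' y y' = 0 := by
    intro g g' y y'
    have := b3 g g' y y'
    rw [bracket_rk u u] at this
    linear_combination this
  rw [rk_mul_rk, ← rk_smul_left]
  by_cases h5 : ∀ g : StrongDual ℂ E, g a = g u * v a
  · congr 1
    refine (SeparatingDual.eq_iff_forall_dual_eq (R := ℂ)).mpr fun g => ?_
    rw [h5 g]
    simp [mul_comm]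
  have h6 := (absorb_of_bracket hvu h4).resolve_left h5
  push Not at h5
  obtain ⟨g, hg⟩ := h5
  have h7 := b2 g v y₁ u
  rw [bracket_rk, hy₁, hvu] at h7
  have h10 : (v ∘L F x e₀) u = 0 := h1
  rw [h10] at h7
  have h8 : b u = 0 := (mul_eq_zero.mp (show b u * (g a - g u * v a) = 0 by
    linear_combination -h7)).resolve_right (sub_ne_zero.mpr hg)
  have h9 : b = 0 := by
    ext y
    rw [h6 y, h8]
    simp
  ext; simp [h9]

theorem exists_eq_rk_of_axes (hF : ∀ x f, Minors (F x f)) (hne : ∀ x f, F x f = 0 → x = 0 ∨ f = 0)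
    {e : X} {e₀ : Y} {u : E} {v : StrongDual ℂ E} (he : F e e₀ = rk u v) (hvu : v u = 1)
    (hS : ∀ x, F x e₀ * rk u v = F x e₀) (hT : ∀ f, rk u v * F e f = F e f) :
    ∃ (S : X →ₗ[ℂ] E) (T : Y →ₗ[ℂ] StrongDual ℂ E), ∀ x f, F x f = rk (S x) (T f) :=
  ⟨(ContinuousLinearMap.apply ℂ E u : (E →L[ℂ] E) →ₗ[ℂ] E) ∘ₗ F.flip e₀,
    (ContinuousLinearMap.compL ℂ E E ℂ v : (E →L[ℂ] E) →ₗ[ℂ] StrongDual ℂ E) ∘ₗ F e,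
    eq_rk_of_axes hF hne he hvu _ _ (fun x => mul_rk_eq_iff.mp (hS x)) fun f => (hT f).symm⟩

/-- Classification of nondegenerate bilinear maps into the operators of rank at most one. -/
theorem exists_eq_rk (hF : ∀ x f, Minors (F x f)) (hne : ∀ x f, F x f = 0 → x = 0 ∨ f = 0)
    (hnd : ∀ (y : E) (g : StrongDual ℂ E), (∀ x f, g (F x f y) = 0) → y = 0 ∨ g = 0)
    {e : X} {e₀ : Y} {u : E} {v : StrongDual ℂ E} (he : F e e₀ = rk u v) (hvu : v u = 1) :
    (∃ (S : X →ₗ[ℂ] E) (T : Y →ₗ[ℂ] StrongDual ℂ E), ∀ x f, F x f = rk (S x) (T f)) ∨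
      ∃ (S : Y →ₗ[ℂ] E) (T : X →ₗ[ℂ] StrongDual ℂ E), ∀ x f, F x f = rk (S f) (T x) := by
  have hu : u ≠ 0 := fun h => by simp [h] at hvu
  have hv : v ≠ 0 := fun h => by simp [h] at hvu
  have h1 := absorb_uniform (P := rk u v) (F.flip e₀) fun x =>
    absorb_or hvu (hF x e₀) (by simpa [he] using hF (x + e) e₀)
  have h2 := absorb_uniform (P := rk u v) (F e) fun f =>
    absorb_or hvu (hF e f) (by simpa [he] using hF e (f + e₀))
  simp only [LinearMap.flip_apply] at h1
  have hdim : (∀ y, v y = 0 → y = 0) → rk u v = 1 := by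
    intro h
    ext y
    have := h (y - v y • u) (by simp [hvu])
    simpa using (sub_eq_zero.mp this).symm
  have hdim' : (∀ g : StrongDual ℂ E, g u = 0 → g = 0) → rk u v = 1 := by
    intro h
    refine hdim fun y hy => SeparatingDual.eq_zero_of_forall_dual_eq_zero (R := ℂ) fun g => ?_
    have := DFunLike.congr_fun (h (g - g u • v) (by simp [hvu])) y
    simpa [hy] using this
  have caseA := exists_eq_rk_of_axes hF hne he hvu
  rcases h1 with h1 | h1 <;> rcases h2 with h2 | h2
  -- All values have range in the line of `u`. Nondegeneracy then kills every functional vanishing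
  -- at `u`, so `E` is a line, `u ⊗ v` is the identity and the product case applies. The last case
  -- is dual.
  · have h3 := absorb_left_of_axes hF hne he hvu h1 h2
    left
    have : rk u v = 1 := hdim' fun g hg => (hnd u g fun x f => by
      rw [← h3 x f]; simp [hg]).resolve_left hu
    exact caseA (by simp [this]) (by simp [this])
  · right
    obtain ⟨S, T, h⟩ := exists_eq_rk_of_axes (F := F.flip) (fun x f => hF f x)
      (fun x f h => (hne f x h).symm) he hvu h2 h1
    exact ⟨S, T, fun x f => h f x⟩
  · left
    exact caseA h1 h2
  · have h3 := absorb_right_of_axes hF hne he hvu h1 h2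
    left
    have : rk u v = 1 := hdim fun y hy => (hnd y v fun x f => by
      rw [← h3 x f]; simp [hy]).resolve_right hv
    exact caseA (by simp [this]) (by simp [this])

end Minors

/-! ### From an algebraic intertwining relation to a bounded isomorphism. -/

section Intertwining

variable {E : Type*} [NormedAddCommGroup E] [NormedSpace ℂ E]

/-- The separating functionals `T z` give `φ C ∘ S = c • S ∘ α C`; a rank one `φ C` not vanishing at
`S w₀` puts any prescribed vector in the range of `S`. The uses are `V = E` with `α` the inclusion
and `V = E'` with `α` the dual operator. -/
theorem exists_intertwiner [CompleteSpace E] {V : Type*} [NormedAddCommGroup V] [NormedSpace ℂ V]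
    [CompleteSpace V] [Nontrivial V] {Z ι : Type*} (φ : ι → E →L[ℂ] E)
    (hrange : ∀ y g, ∃ C, φ C = rk y g) (α : ι → V →L[ℂ] V) (p : Z → StrongDual ℂ V)
    (hp : ∀ w, (∀ z, p z w = 0) → w = 0) (S : V →ₗ[ℂ] E) (T : Z → StrongDual ℂ E)
    (hT : ∀ y, (∀ z, T z y = 0) → y = 0) (hTS : ∀ z w, T z (S w) = p z w) {c : ℂ}
    (h : ∀ C z w, T z (φ C (S w)) = c * p z (α C w)) :
    ∃ R : V ≃L[ℂ] E, ∀ C,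
      φ C = c • ((R : V →L[ℂ] E) ∘L α C ∘L (R.symm : E →L[ℂ] V)) := by
  have hker : ∀ w, S w = 0 → w = 0 := fun w hw => hp w fun z => by rw [← hTS, hw, map_zero]
  have hinj : Function.Injective S := (injective_iff_map_eq_zero S).mpr hker
  have hφ : ∀ C w, φ C (S w) = c • S (α C w) := fun C w => by
    refine sub_eq_zero.mp (hT _ fun z => ?_)
    rw [map_sub, h, map_smul, hTS, smul_eq_mul, sub_self]
  obtain ⟨w₀, hw₀⟩ := exists_ne (0 : V)
  obtain ⟨g, hg⟩ := exists_dual_eq_one fun h0 => hw₀ (hker w₀ h0)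
  have hsurj : Function.Surjective S := fun y => by
    obtain ⟨C, hC⟩ := hrange y g
    have := hφ C w₀
    rw [hC, rk_apply, hg, one_smul] at this
    exact ⟨c • α C w₀, by rw [map_smul, this]⟩
  let L := LinearEquiv.ofBijective S ⟨hinj, hsurj⟩
  have hL : ∀ w, L w = S w := fun _ => rfl
  -- Closed graph theorem: `p z ∘ S⁻¹ = T z` is continuous and the `p z` separate points.
  have hcont : Continuous L.symm := by
    refine LinearMap.continuous_of_seq_closed_graph (g := (L.symm : E →ₗ[ℂ] V))
      fun s y w hs hw => ?_
    refine sub_eq_zero.mp (hp _ fun z => ?_)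
    rw [map_sub, sub_eq_zero]
    have h1 := ((p z).continuous.tendsto w).comp hw
    have h2 := ((T z).continuous.tendsto y).comp hs
    have h3 : ∀ y, p z (L.symm y) = T z y := fun y => by
      rw [← hTS, ← hL, L.apply_symm_apply]
    have h4 : (p z ∘ (L.symm : E →ₗ[ℂ] V) ∘ s) = T z ∘ s := funext fun n => h3 (s n)
    rw [h4] at h1
    exact (tendsto_nhds_unique h1 h2).trans (h3 y).symm
  let R := (L.symm.toContinuousLinearEquivOfContinuous hcont).symm
  have hR : ∀ w, R w = S w := fun _ => rfl
  refine ⟨R, fun C => ?_⟩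
  ext y
  obtain ⟨w, rfl⟩ := R.surjective y
  change φ C (R w) = c • R (α C (R.symm (R w)))
  rw [R.symm_apply_apply]
  exact hφ C w

end Intertwining

/-! ### The standard form from the functionals `T ↦ f (T x)`. -/

section TraceForm

variable {E : Type*} [NormedAddCommGroup E] [NormedSpace ℂ E]

/-- A bilinear form vanishing on orthogonal pairs is a multiple of the pairing. -/
theorem eq_mul_pairing (τ : E →ₗ[ℂ] StrongDual ℂ E →ₗ[ℂ] ℂ) (h : ∀ x f, f x = 0 → τ x f = 0)
    {e : E} {e₀ : StrongDual ℂ E} (he : e₀ e = 1) (x : E) (f : StrongDual ℂ E) :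
    τ x f = τ e e₀ * f x := by
  have h1 := h e (f - f e • e₀) (by simp [he])
  have h2 := h (x - e₀ x • e) e₀ (by simp [he])
  have h3 := h (x - e₀ x • e + e) (f - f e • e₀ - (f x - e₀ x * f e) • e₀) (by simp [he])
  simp only [map_sub, map_add, map_smul, LinearMap.sub_apply, LinearMap.add_apply,
    LinearMap.smul_apply, smul_eq_mul] at h1 h2 h3
  linear_combination h3 + (f e + (f x - e₀ x * f e)) * h2 + (e₀ x - 1) * h1

theorem Minors.smul {M : E →L[ℂ] E} (h : Minors M) (c : ℂ) : Minors (c • M) := by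
  intro g g' y y'
  have := h g g' y y'
  simp only [smul_apply, map_smul, smul_eq_mul]
  linear_combination c ^ 2 * this

/-- Each minor of `M + t • N` is a polynomial of degree at most 2 in `t`; interpolating at `1`,
`-1`, `2` gives its value at `0`. -/
theorem minors_of_pencil {M N : E →L[ℂ] E} (h : ∀ t : ℂ, t ≠ 0 → Minors (M + t • N)) :
    Minors M := by
  intro g g' y y'
  have h1 := h 1 one_ne_zero g g' y y'
  have h2 := h (-1) (neg_ne_zero.mpr one_ne_zero) g g' y y'
  have h3 := h 2 two_ne_zero g g' y y'
  simp only [add_apply, smul_apply, map_add, map_smul, smul_eq_mul] at h1 h2 h3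
  linear_combination h1 + h2 / 3 - h3 / 3

variable {A : NonUnitalSubalgebra ℂ (E →L[ℂ] E)} {φ : A → A}

/-- `W` represents the functional `T ↦ f (T x)` through `φ`. -/
def Represents (φ : A → A) (x : E) (f : StrongDual ℂ E) (W : E →L[ℂ] E) : Prop :=
  IsFR W ∧ ∀ T : A, ftr (W * (φ T : E →L[ℂ] E)) = f ((T : E →L[ℂ] E) x)

theorem Represents.add_left {x x' : E} {f : StrongDual ℂ E} {W W' : E →L[ℂ] E}
    (h : Represents φ x f W) (h' : Represents φ x' f W') : Represents φ (x + x') f (W + W') :=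
  ⟨h.1.add h'.1, fun T => by
    rw [add_mul, ftr_add (h.1.mul_right _) (h'.1.mul_right _), h.2, h'.2, map_add, map_add]⟩

theorem Represents.add_right {x : E} {f f' : StrongDual ℂ E} {W W' : E →L[ℂ] E}
    (h : Represents φ x f W) (h' : Represents φ x f' W') : Represents φ x (f + f') (W + W') :=
  ⟨h.1.add h'.1, fun T => by
    rw [add_mul, ftr_add (h.1.mul_right _) (h'.1.mul_right _), h.2, h'.2, add_apply]⟩

theorem Represents.smul_left {x : E} {f : StrongDual ℂ E} {W : E →L[ℂ] E}
    (h : Represents φ x f W) (c : ℂ) : Represents φ (c • x) f (c • W) :=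
  ⟨h.1.smul c, fun T => by
    rw [smul_mul_assoc, ftr_smul (h.1.mul_right _), h.2, map_smul, map_smul, smul_eq_mul]⟩

theorem Represents.smul_right {x : E} {f : StrongDual ℂ E} {W : E →L[ℂ] E}
    (h : Represents φ x f W) (c : ℂ) : Represents φ x (c • f) (c • W) :=
  ⟨h.1.smul c, fun T => by
    rw [smul_mul_assoc, ftr_smul (h.1.mul_right _), h.2, smul_apply, smul_eq_mul]⟩

theorem represents_rk {x a : E} {f b : StrongDual ℂ E}
    (h : ∀ T : A, b ((φ T : E →L[ℂ] E) a) = f ((T : E →L[ℂ] E) x)) :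
    Represents φ x f (rk a b) :=
  ⟨isFR_rk a b, fun T => by rw [rk_mul, ftr_rk, ← h]; rfl⟩

theorem Represents.apply {x : E} {f : StrongDual ℂ E} {W : E →L[ℂ] E}
    (h : Represents φ x f W) {C : A} {y : E} {g : StrongDual ℂ E}
    (hC : (φ C : E →L[ℂ] E) = rk y g) : g (W y) = f ((C : E →L[ℂ] E) x) := by
  rw [← h.2, hC, mul_rk, ftr_rk]

/-- Rank one operators in the range of `φ` read off every coefficient `g (W y)`. Uniqueness is what
makes the choice of `W` bilinear. -/
theorem Represents.unique (hrange : ∀ y g, ∃ C : A, (φ C : E →L[ℂ] E) = rk y g)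
    {x : E} {f : StrongDual ℂ E} {W W' : E →L[ℂ] E}
    (h : Represents φ x f W) (h' : Represents φ x f W') : W = W' := by
  ext y
  refine (SeparatingDual.eq_iff_forall_dual_eq (R := ℂ)).mpr fun g => ?_
  obtain ⟨C, hC⟩ := hrange y g
  rw [h.apply hC, h'.apply hC]

/-- Scaling covers `f x ≠ 0`; if `f x = 0`, write `f = (f + h) - h` with `h x = 1`. -/
theorem exists_represents (hstar : ∀ (x : E) (f : StrongDual ℂ E), f x = 1 →
      ∃ (a : E) (b : StrongDual ℂ E),
        ∀ T : A, b ((φ T : E →L[ℂ] E) a) = f ((T : E →L[ℂ] E) x))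
    (x : E) (f : StrongDual ℂ E) : ∃ W, Represents φ x f W := by
  have h0 : ∀ f : StrongDual ℂ E, f x ≠ 0 → ∃ W, Represents φ x f W := by
    intro f hf
    obtain ⟨a, b, h⟩ := hstar ((f x)⁻¹ • x) f (by simpa using inv_mul_cancel₀ hf)
    have := (represents_rk h).smul_left (f x)
    rw [smul_inv_smul₀ hf] at this
    exact ⟨_, this⟩
  by_cases hf : f x = 0
  · by_cases hx : x = 0
    · subst hx
      exact ⟨0, ⟨[], rfl⟩, fun T => by
        rw [zero_mul, map_zero, map_zero, ← opList_nil, ftr_opList, trList_nil]⟩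
    · obtain ⟨h, hh⟩ := exists_dual_eq_one hx
      obtain ⟨W, hW⟩ := h0 (f + h) (by simp [hf, hh])
      obtain ⟨W', hW'⟩ := h0 h (by simp [hh])
      have := hW.add_right (hW'.smul_right (-1))
      refine ⟨W + (-1 : ℂ) • W', ?_⟩
      convert this using 1
      ext y
      simp
  · exact h0 f hf

/-- A map for which every functional `T ↦ f (T x)` with `f x = 1` is of the form
`T ↦ b (φ T a)` is a multiple of an automorphism or an antiautomorphism. -/
theorem hasStandardForm_of_functionals [CompleteSpace E] (hA : IsStandard A) {m : ℕ} (hm : m ≠ 0)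
    (hrange : ∀ y g, ∃ C : A, (φ C : E →L[ℂ] E) = rk y g)
    (hstar : ∀ (x : E) (f : StrongDual ℂ E), f x = 1 →
      ∃ (a : E) (b : StrongDual ℂ E), b a ^ m = 1 ∧
        ∀ T : A, b ((φ T : E →L[ℂ] E) a) = f ((T : E →L[ℂ] E) x)) :
    HasStandardForm m φ := by
  rcases subsingleton_or_nontrivial E with hE | hE
  · exact ⟨1, one_pow m, Or.inl ⟨ContinuousLinearEquiv.refl ℂ E, fun T => by
      ext y; exact Subsingleton.elim _ _⟩⟩
  choose W₀ hW₀ using exists_represents (φ := φ) fun x f h =>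
    let ⟨a, b, h⟩ := hstar x f h
    ⟨a, b, h.2⟩
  let W : E →ₗ[ℂ] StrongDual ℂ E →ₗ[ℂ] E →L[ℂ] E := LinearMap.mk₂ ℂ W₀
    (fun x x' f => (hW₀ _ _).unique hrange ((hW₀ x f).add_left (hW₀ x' f)))
    (fun c x f => (hW₀ _ _).unique hrange ((hW₀ x f).smul_left c))
    (fun x f f' => (hW₀ _ _).unique hrange ((hW₀ x f).add_right (hW₀ x f')))
    (fun c x f => (hW₀ _ _).unique hrange ((hW₀ x f).smul_right c))
  have hW : ∀ x f, Represents φ x f (W x f) := hW₀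
  clear_value W
  clear hW₀ W₀
  have hW1 : ∀ x f, f x = 1 → ∃ a b, W x f = rk a b ∧ b a ^ m = 1 := by
    intro x f hf
    obtain ⟨a, b, h1, h2⟩ := hstar x f hf
    exact ⟨a, b, (hW x f).unique hrange (represents_rk h2), h1⟩
  have hmin0 : ∀ (x : E) (f : StrongDual ℂ E), f x ≠ 0 → Minors (W x f) := by
    intro x f hf
    obtain ⟨a, b, h, -⟩ := hW1 ((f x)⁻¹ • x) f (by simpa using inv_mul_cancel₀ hf)
    have := (h ▸ minors_rk a b).smul (f x)
    rwa [← LinearMap.smul_apply, ← map_smul, smul_inv_smul₀ hf] at this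
  have hmin : ∀ x f, Minors (W x f) := by
    intro x f
    by_cases hf : f x = 0
    · by_cases hx : x = 0
      · rw [hx, map_zero]
        intro g g' y y'
        simp
      · obtain ⟨h, hh⟩ := exists_dual_eq_one hx
        refine minors_of_pencil (N := W x h) fun t ht => ?_
        rw [← map_smul, ← map_add]
        exact hmin0 x _ (by simpa [hf, hh] using ht)
    · exact hmin0 x f hf
  let τ : E →ₗ[ℂ] StrongDual ℂ E →ₗ[ℂ] ℂ := LinearMap.mk₂ ℂ (fun x f => ftr (W x f))
    (fun x x' f => by rw [map_add, LinearMap.add_apply, ftr_add (hW _ _).1 (hW _ _).1])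
    (fun c x f => by rw [map_smul, LinearMap.smul_apply, ftr_smul (hW _ _).1, smul_eq_mul])
    (fun x f f' => by rw [map_add, ftr_add (hW _ _).1 (hW _ _).1])
    (fun c x f => by rw [map_smul, ftr_smul (hW _ _).1, smul_eq_mul])
  have hτ : ∀ x f, ftr (W x f) = τ x f := fun _ _ => rfl
  have hτ1 : ∀ x f, f x = 1 → τ x f ^ m = 1 := by
    intro x f hf
    obtain ⟨a, b, h1, h2⟩ := hW1 x f hf
    rw [← hτ, h1, ftr_rk, h2]
  -- On the line `f + t h` the pairing with `x` stays 1, so the trace stays an `m`-th root of unity;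
  -- if `τ x h ≠ 0`, some `t` would make it 0.
  have hτ0 : ∀ x f, f x = 0 → τ x f = 0 := by
    intro x h hh
    by_contra hne
    have hx : x ≠ 0 := fun hx => hne (by simp [hx])
    obtain ⟨f, hf⟩ := exists_dual_eq_one hx
    have := hτ1 x (f + (-(τ x f) / τ x h) • h) (by simp [hf, hh])
    rw [map_add, map_smul, smul_eq_mul, div_mul_cancel₀ _ hne, add_neg_cancel, zero_pow hm] at this
    exact zero_ne_one this
  obtain ⟨e, he⟩ := exists_ne (0 : E)
  obtain ⟨e₀, he₀⟩ := exists_dual_eq_one he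
  have hc := eq_mul_pairing τ hτ0 he₀
  have hcm := hτ1 e e₀ he₀
  set c := τ e e₀
  have hc0 : c ≠ 0 := fun h => by
    rw [h, zero_pow hm] at hcm
    exact zero_ne_one hcm
  have hne : ∀ x f, W x f = 0 → x = 0 ∨ f = 0 := by
    intro x f h0
    by_contra! hxf
    obtain ⟨g, hg⟩ := exists_dual_eq_one hxf.1
    obtain ⟨y, hy⟩ := exists_apply_eq_one hxf.2
    have h1 := (hW x f).2 ⟨rk y g, hA.mem (isFR_rk y g)⟩
    rw [h0, zero_mul, ← opList_nil, ftr_opList, trList_nil] at h1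
    simp [hg, hy] at h1
  have hnd : ∀ (y : E) (g : StrongDual ℂ E), (∀ x f, g (W x f y) = 0) → y = 0 ∨ g = 0 := by
    intro y g h0
    -- Since `φ` is not known to be linear or injective, scale 0 is needed as well: `C = 0` for both
    -- `s = 1` and `s = 0` gives `rk y g = φ 0 = 0`.
    have h1 : ∀ s : ℂ, ∃ C : A, (φ C : E →L[ℂ] E) = rk y (s • g) ∧ C = 0 := by
      intro s
      obtain ⟨C, hC⟩ := hrange y (s • g)
      refine ⟨C, hC, ?_⟩
      ext x
      refine SeparatingDual.eq_zero_of_forall_dual_eq_zero (R := ℂ) fun f => ?_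
      rw [← (hW x f).apply hC]
      simp [h0]
    obtain ⟨C, hC, rfl⟩ := h1 1
    obtain ⟨C, hC', rfl⟩ := h1 0
    rw [hC] at hC'
    by_contra! hyg
    refine rk_ne_zero hyg.1 hyg.2 ?_
    rwa [rk_smul_right, rk_smul_right, one_smul, zero_smul] at hC'
  -- After division by `c` the trace of the value at `(x, f)` is `f x`, as `exists_intertwiner`
  -- requires.
  have hF : ∀ x f, Minors ((c⁻¹ • W) x f) := fun x f => (hmin x f).smul _
  obtain ⟨a, b, hab, -⟩ := hW1 e e₀ he₀
  have hba : b a = c := by rw [← ftr_rk, ← hab, hτ]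
  have hF1 : (c⁻¹ • W) e e₀ = rk (c⁻¹ • a) b := by
    rw [rk_smul_left, ← hab]
    rfl
  have hv0 : b ≠ 0 := fun h => hc0 (by rw [← hba, h]; rfl)
  have hξ : (c⁻¹) ^ m = 1 := by rw [inv_pow, hcm, inv_one]
  have hWF : ∀ x f, W x f = c • (c⁻¹ • W) x f := fun x f => (smul_inv_smul₀ hc0 (W x f)).symm
  have hφ : ∀ x f s t, (c⁻¹ • W) x f = rk s t → t s = f x ∧
      ∀ C : A, t ((φ C : E →L[ℂ] E) s) = c⁻¹ * f ((C : E →L[ℂ] E) x) := by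
    intro x f s t h
    have h1 := hWF x f
    rw [h, ← rk_smul_right] at h1
    constructor
    · have h2 := hc x f
      rw [← hτ, h1, ftr_rk] at h2
      exact mul_left_cancel₀ hc0 h2
    · intro C
      have h2 := (hW x f).2 C
      rw [h1, rk_mul, ftr_rk] at h2
      rw [← h2]
      simp [hc0]
  rcases exists_eq_rk hF (fun x f h => hne x f (by rw [hWF, h, smul_zero]))
    (fun y g h => hnd y g fun x f => by rw [hWF, smul_apply, map_smul, h, smul_zero])
    hF1 (by simp [hba, hc0]) with ⟨S, T, hST⟩ | ⟨S, T, hST⟩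
  · obtain ⟨R, hR⟩ := exists_intertwiner (fun C : A => (φ C : E →L[ℂ] E)) hrange
      (fun C : A => (C : E →L[ℂ] E)) (fun f : StrongDual ℂ E => f)
      (fun w hw => SeparatingDual.eq_zero_of_forall_dual_eq_zero (R := ℂ) hw) S T
      (fun y hy => (hnd y b fun x f => by rw [hWF, hST]; simp [hy]).resolve_right hv0)
      (fun f x => (hφ x f _ _ (hST x f)).1) (c := c⁻¹)
      (fun C f x => (hφ x f _ _ (hST x f)).2 C)
    exact ⟨c⁻¹, hξ, Or.inl ⟨R, hR⟩⟩
  · have : Nontrivial (StrongDual ℂ E) := ⟨b, 0, hv0⟩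
    obtain ⟨R, hR⟩ := exists_intertwiner (fun C : A => (φ C : E →L[ℂ] E)) hrange
      (fun C : A => dualOp (C : E →L[ℂ] E))
      (fun x : E => ContinuousLinearMap.apply ℂ ℂ x)
      (fun f hf => by ext x; exact hf x) S T
      (fun y hy => (hnd y b fun x f => by rw [hWF, hST]; simp [hy]).resolve_right hv0)
      (fun x f => (hφ x f _ _ (hST x f)).1) (c := c⁻¹)
      (fun C x f => (hφ x f _ _ (hST x f)).2 C)
    exact ⟨c⁻¹, hξ, Or.inr ⟨R, hR⟩⟩

end TraceForm

/-! ### Jordan automorphisms preserve rank bounds and traces. -/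

section Jordan

variable {E : Type*} [NormedAddCommGroup E] [NormedSpace ℂ E]
  {A : NonUnitalSubalgebra ℂ (E →L[ℂ] E)} {θ : A ≃ₗ[ℂ] A}

theorem IsAlgAut.isJordanAut (h : IsAlgAut θ) : IsJordanAut θ := fun x y => by
  rw [map_add, h, h]

theorem IsJordanAut.map_mul_self (h : IsJordanAut θ) (x : A) : θ (x * x) = θ x * θ x := by
  have h1 := h x x
  rw [← two_smul ℂ, ← two_smul ℂ (θ x * θ x), map_smul] at h1
  exact smul_right_injective _ (two_ne_zero (α := ℂ)) h1

theorem IsJordanAut.map_mul_mul (h : IsJordanAut θ) (x y : A) :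
    θ (x * y * x) = θ x * θ y * θ x := by
  have key : ∀ x y : A, (x * y + y * x) * x + x * (x * y + y * x) =
      (2 : ℂ) • (x * y * x) + ((x * x) * y + y * (x * x)) := by
    intro x y
    rw [two_smul]
    simp only [add_mul, mul_add, mul_assoc]
    abel
  have h1 := h (x * y + y * x) x
  rw [key, map_add, map_smul, h (x * x) y, h, h.map_mul_self, key] at h1
  exact smul_right_injective _ (two_ne_zero (α := ℂ)) (add_right_cancel h1)

/-- From `a b a = f (b x) • a` and surjectivity, `θ a * b * θ a` is a multiple of `θ a` for every
`b` in `A`. A suitable rank one `b` refutes rank at least two, and `a * a = f x • a` fixes the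
trace. -/
theorem IsJordanAut.map_rk (h : IsJordanAut θ) (hA : IsStandard A) {a : A} {x : E}
    {f : StrongDual ℂ E} (ha : (a : E →L[ℂ] E) = rk x f) :
    ∃ x' f', (θ a : E →L[ℂ] E) = rk x' f' ∧ f' x' = f x := by
  have h1 : ∀ b : A, ∃ c : ℂ, (θ a : E →L[ℂ] E) * (b : E →L[ℂ] E) * (θ a : E →L[ℂ] E) =
      c • (θ a : E →L[ℂ] E) := by
    intro b
    obtain ⟨b, rfl⟩ := θ.surjective b
    refine ⟨f ((b : E →L[ℂ] E) x), ?_⟩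
    have h2 : a * b * a = f ((b : E →L[ℂ] E) x) • a := by
      apply Subtype.ext
      change (a : E →L[ℂ] E) * (b : E →L[ℂ] E) * (a : E →L[ℂ] E) = _ • (a : E →L[ℂ] E)
      rw [ha, rk_mul, rk_mul_rk]
      rfl
    have h3 := congrArg θ h2
    rw [h.map_mul_mul, map_smul] at h3
    exact congrArg Subtype.val h3
  have h4 : FRLE 1 (θ a : E →L[ℂ] E) := by
    refine frle_of_forall fun v hv => ?_
    obtain ⟨g, hg⟩ := exists_dual_family hv
    obtain ⟨c, hc⟩ := h1 ⟨rk (v 1) (g 0), hA.mem (isFR_rk _ _)⟩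
    have h5 := DFunLike.congr_fun hc (v 0)
    have h6 := congrArg (g 1) h5
    simp [hg] at h6
  obtain ⟨x', f', h5⟩ := h4.exists_rk
  refine ⟨x', f', h5, ?_⟩
  by_cases h0 : θ a = 0
  · have h6 : a = 0 := by simpa using h0
    rw [h6] at ha
    rw [h0] at h5
    rw [← ftr_rk, ← ftr_rk, ← ha, ← h5]
  · have h6 : a * a = f x • a := by
      apply Subtype.ext
      change (a : E →L[ℂ] E) * (a : E →L[ℂ] E) = _ • (a : E →L[ℂ] E)
      rw [ha, rk_mul_rk]
    have h7 := congrArg θ h6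
    rw [h.map_mul_self, map_smul] at h7
    have h8 : θ a * θ a = f' x' • θ a := by
      apply Subtype.ext
      change (θ a : E →L[ℂ] E) * (θ a : E →L[ℂ] E) = _ • (θ a : E →L[ℂ] E)
      rw [h5, rk_mul_rk]
    exact smul_left_injective ℂ h0 (h8.symm.trans h7)

theorem IsJordanAut.map_frle (h : IsJordanAut θ) (hA : IsStandard A) {d : ℕ} {a : A}
    (ha : FRLE d (a : E →L[ℂ] E)) :
    FRLE d (θ a : E →L[ℂ] E) ∧ ftr (θ a : E →L[ℂ] E) = ftr (a : E →L[ℂ] E) := by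
  obtain ⟨l, hl, hla⟩ := ha
  suffices H : ∀ (l) (a : A), opList l = (a : E →L[ℂ] E) →
      FRLE l.length (θ a : E →L[ℂ] E) ∧ ftr (θ a : E →L[ℂ] E) = ftr (a : E →L[ℂ] E) from
    ⟨(H l a hla).1.mono hl, (H l a hla).2⟩
  clear hla hl a l
  intro l
  induction l with
  | nil =>
    intro a ha
    have h0 : a = 0 := Subtype.ext ha.symm
    rw [h0, map_zero]
    exact ⟨⟨[], le_rfl, rfl⟩, rfl⟩
  | cons p l ih =>
    intro a ha
    let a₁ : A := ⟨rk p.1 p.2, hA.mem (isFR_rk _ _)⟩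
    let a₂ : A := ⟨opList l, hA.mem ⟨l, rfl⟩⟩
    have h12 : a = a₁ + a₂ := Subtype.ext (by rw [← ha, opList_cons]; rfl)
    obtain ⟨x', f', h3, h4⟩ := h.map_rk hA (a := a₁) rfl
    obtain ⟨h5, h6⟩ := ih a₂ rfl
    have h7 : (θ a : E →L[ℂ] E) = rk x' f' + (θ a₂ : E →L[ℂ] E) := by
      rw [h12, map_add, ← h3]
      rfl
    constructor
    · rw [h7, add_comm, List.length_cons]
      exact h5.add (frle_rk _ _)
    · rw [h7, ftr_add (isFR_rk _ _) h5.isFR, ftr_rk, h4, h6, h12]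
      rw [← ftr_rk, ← ftr_add (isFR_rk _ _) ⟨l, rfl⟩]
      rfl

end Jordan

/-! ### The two-variable product and roots of rank one idempotents. -/

section SingleVariable

variable {E : Type*} [NormedAddCommGroup E] [NormedSpace ℂ E]

/-- The product `Bʳ X Bˢ` for `ε = 0`, and its Jordan version for `ε = 1`. -/
noncomputable def sandwich (ε : ℂ) (r s : ℕ) (B X : E →L[ℂ] E) : E →L[ℂ] E :=
  B ^ r * X * B ^ s + ε • (B ^ s * X * B ^ r)

theorem sandwich_eq_smul {ε : ℂ} {r s : ℕ} {B X : E →L[ℂ] E} (h : Commute B X) :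
    sandwich ε r s B X = (1 + ε) • (B ^ (r + s) * X) := by
  have h1 : ∀ r s : ℕ, B ^ r * X * B ^ s = B ^ (r + s) * X := fun r s => by
    rw [mul_assoc, ← (h.pow_left s).eq, ← mul_assoc, pow_add]
  rw [sandwich, h1, h1, add_comm s r, add_smul, one_smul]

theorem isFR_mul_mul_pow {r s : ℕ} (hrs : r + s ≠ 0) {B : E →L[ℂ] E} (hB : IsFR B)
    (X : E →L[ℂ] E) : IsFR (B ^ r * X * B ^ s) := by
  by_cases hs : s = 0
  · exact ((hB.pow (by omega)).mul_right _).mul_right _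
  · exact (hB.pow hs).mul_left _

theorem ftr_mul_mul_pow {r s : ℕ} {B : E →L[ℂ] E} (hB : IsFR B)
    (X : E →L[ℂ] E) : ftr (B ^ r * X * B ^ s) = ftr (B ^ (r + s) * X) := by
  by_cases hs : s = 0
  · simp [hs]
  · rw [ftr_mul_comm (hB.pow hs), ← mul_assoc, ← pow_add, add_comm s r]

theorem ftr_sandwich {ε : ℂ} {r s : ℕ} (hrs : r + s ≠ 0) {B : E →L[ℂ] E} (hB : IsFR B)
    (X : E →L[ℂ] E) : ftr (sandwich ε r s B X) = (1 + ε) * ftr (B ^ (r + s) * X) := by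
  have hsr : s + r ≠ 0 := by omega
  rw [sandwich, ftr_add (isFR_mul_mul_pow hrs hB X) ((isFR_mul_mul_pow hsr hB X).smul ε),
    ftr_smul (isFR_mul_mul_pow hsr hB X), ftr_mul_mul_pow hB, ftr_mul_mul_pow hB, add_comm s r]
  ring

theorem FRLE.pow {d : ℕ} {T : E →L[ℂ] E} (h : FRLE d T) {n : ℕ} (hn : n ≠ 0) :
    FRLE d (T ^ n) := by
  obtain ⟨k, rfl⟩ := Nat.exists_eq_succ_of_ne_zero hn
  rw [pow_succ]
  exact h.mul_left _

/-- The admissible parameters: the plain product with rank one values, and the Jordan product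
with values of rank two. -/
def Admissible (ε : ℂ) (d : ℕ) : Prop := (ε = 0 ∧ d = 1) ∨ (ε = 1 ∧ d = 2)

theorem Admissible.one_add_ne_zero {ε : ℂ} {d : ℕ} (h : Admissible ε d) : 1 + ε ≠ 0 := by
  rcases h with ⟨rfl, -⟩ | ⟨rfl, -⟩ <;> norm_num

theorem frle_sandwich {ε : ℂ} {d r s : ℕ} (hε : Admissible ε d) (hrs : r + s ≠ 0)
    {B X : E →L[ℂ] E} (h : FRLE 1 B ∨ FRLE 1 X) : FRLE d (sandwich ε r s B X) := by
  have h1 : ∀ {r s : ℕ}, r + s ≠ 0 → FRLE 1 (B ^ r * X * B ^ s) := by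
    intro r s hrs
    rcases h with h | h
    · by_cases hs : s = 0
      · exact ((h.pow (by omega)).mul_right _).mul_right _
      · exact (h.pow hs).mul_left _
    · exact (h.mul_left _).mul_right _
  rcases hε with ⟨rfl, rfl⟩ | ⟨rfl, rfl⟩
  · rw [sandwich, zero_smul, add_zero]
    exact h1 hrs
  · exact (h1 hrs).add ((h1 (by omega)).smul _)

/-- An idempotent `R` absorbs its powers, so multiplying the sandwich by `R` on both sides leaves
`(1 + ε) • (R * T * R)`. -/
theorem frle_of_sandwich {ε : ℂ} {d r s : ℕ} (hε : Admissible ε d) {T : E →L[ℂ] E}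
    (h : ∀ R : E →L[ℂ] E, R * R = R → FRLE (d + 1) R → FRLE d (sandwich ε r s R T)) :
    FRLE d T := by
  refine frle_of_compression fun R hR hd => ?_
  have h1 : ∀ n : ℕ, R * R ^ n = R := fun n => by
    rw [← pow_succ']
    exact IsIdempotentElem.pow_succ_eq n hR
  have h2 : ∀ n : ℕ, R ^ n * R = R := fun n => by
    rw [← pow_succ]
    exact IsIdempotentElem.pow_succ_eq n hR
  have h3 : R * sandwich ε r s R T * R = (1 + ε) • (R * T * R) := by
    have : ∀ r s : ℕ, R * (R ^ r * T * R ^ s) * R = R * T * R := fun r s => by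
      calc R * (R ^ r * T * R ^ s) * R = (R * R ^ r) * T * (R ^ s * R) := by
            simp only [mul_assoc]
        _ = R * T * R := by rw [h1, h2]
    rw [sandwich, mul_add, add_mul, mul_smul_comm, smul_mul_assoc, this, this, add_smul, one_smul]
  have h4 := (((h R hR hd).mul_left R).mul_right R).smul (1 + ε)⁻¹
  rwa [h3, inv_smul_smul₀ hε.one_add_ne_zero] at h4

/-- Spectral data of a root of a rank one idempotent. -/
theorem root_of_idempotent {T : E →L[ℂ] E} {m : ℕ} {u : E} {v : StrongDual ℂ E} (hvu : v u = 1)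
    (hT : T ^ m = rk u v) : ∃ c : ℂ, c ^ m = 1 ∧ T u = c • u ∧ ∀ y, v (T y) = c * v y := by
  have h1 : T * rk u v = rk u v * T := by rw [← hT, ← pow_succ, ← pow_succ']
  have h2 : ∀ y, v y • T u = v (T y) • u := fun y => by
    simpa using DFunLike.congr_fun h1 y
  have h3 : T u = v (T u) • u := by simpa [hvu] using h2 u
  refine ⟨v (T u), ?_, h3, fun y => ?_⟩
  · have h4 : ∀ k : ℕ, (T ^ k) u = v (T u) ^ k • u := by
      intro k
      induction k with
      | zero => simp
      | succ k ih =>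
        rw [pow_succ', mul_apply_eq_comp, ih, map_smul, h3, smul_smul, pow_succ]
        simp [hvu]
    have h5 := congrArg v (h4 m)
    rw [hT] at h5
    simpa [hvu] using h5.symm
  · have h5 := congrArg v (h2 y)
    simp [hvu] at h5
    linear_combination -h5

theorem eq_smul_rk_of_frle_one {T : E →L[ℂ] E} (h : FRLE 1 T) {u : E} {v : StrongDual ℂ E}
    (hvu : v u = 1) {c : ℂ} (hc : c ≠ 0) (hu : T u = c • u) (hv : ∀ y, v (T y) = c * v y) :
    T = c • rk u v := by
  obtain ⟨a, b, rfl⟩ := h.exists_rk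
  rw [rk_apply] at hu
  have hbu : b u ≠ 0 := fun h0 => by
    rw [h0, zero_smul] at hu
    have := congrArg v hu
    exact hc (by simpa [hvu] using this.symm)
  have ha : a = (c / b u) • u := by
    rw [div_eq_inv_mul, mul_smul, ← hu, inv_smul_smul₀ hbu]
  ext y
  have h1 := hv y
  rw [ha] at h1 ⊢
  simp [hvu] at h1
  simp [smul_smul, h1]

theorem pow_eq_of_orthogonal {Q N : E →L[ℂ] E} (hQ : Q * Q = Q) (hQN : Q * N = 0) (hNQ : N * Q = 0)
    (c : ℂ) {n : ℕ} (hn : n ≠ 0) : (c • Q + N) ^ n = c ^ n • Q + N ^ n := by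
  obtain ⟨k, rfl⟩ := Nat.exists_eq_succ_of_ne_zero hn
  induction k with
  | zero => simp
  | succ k ih =>
    rw [pow_succ, ih k.succ_ne_zero]
    have h1 : N ^ (k + 1) * Q = 0 := by rw [pow_succ, mul_assoc, hNQ, mul_zero]
    simp only [add_mul, mul_add, smul_mul_assoc, mul_smul_comm, hQ, hQN, h1, smul_zero, add_zero,
      zero_add, smul_smul, ← pow_succ, Nat.succ_eq_add_one, ← pow_succ']

/-- Two independent values of `N`, taken modulo `u`, together with `T u = c • u` would give three
independent values of `T`. -/
theorem frle_one_of_frle_two {T N : E →L[ℂ] E} (h : FRLE 2 T) {u : E} {v : StrongDual ℂ E}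
    (hvu : v u = 1) {c : ℂ} (hc : c ≠ 0) (hu : T u = c • u) (hN : T = c • rk u v + N)
    (hvN : ∀ y, v (N y) = 0) : FRLE 1 N := by
  refine frle_of_forall fun w hw => ?_
  obtain ⟨g, hg⟩ := exists_dual_family hw
  have hTw : ∀ i, T (w i) = c • v (w i) • u + N (w i) := fun i => by rw [hN]; simp
  have h3 : LinearIndependent ℂ fun i => T (![u, w 0, w 1] i) := by
    refine linearIndependent_of_det_ne_zero ![v, g 0 - g 0 u • v, g 1 - g 1 u • v] ?_
    rw [Matrix.det_fin_three]
    simp [hu, hTw, hg, hvu, hvN]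
    ring_nf
    exact hc
  exact absurd (h.card_le h3) (by norm_num)

/-- For `m = 2`, `N * N = 0` does not yet give `N ^ (m - 1) = 0`. If `N = w ⊗ z ≠ 0`, choose `e` and
`p` with `z e = p w = 1` and the other relevant pairings zero. For `R = u ⊗ v + e ⊗ p`, the operator
`T * R + R * T = 2c u ⊗ v + w ⊗ p + e ⊗ z` has rank three. -/
theorem eq_zero_of_jordan_frle_two {T N : E →L[ℂ] E} {u : E} {v : StrongDual ℂ E}
    (hvu : v u = 1) {c : ℂ} (hc : c ≠ 0) (hN : T = c • rk u v + N) (hNu : N u = 0)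
    (hvN : ∀ y, v (N y) = 0) (hN1 : FRLE 1 N) (hNN : N * N = 0)
    (h : ∀ R : E →L[ℂ] E, FRLE 2 R → FRLE 2 (T * R + R * T)) : N = 0 := by
  obtain ⟨w, z, rfl⟩ := hN1.exists_rk
  by_contra hne
  have hw : w ≠ 0 := fun h0 => hne (by ext; simp [h0])
  have hz : z ≠ 0 := fun h0 => hne (by ext; simp [h0])
  have hzu : z u = 0 := by simpa [hw] using hNu
  obtain ⟨y, hy⟩ := exists_apply_eq_one hz
  have hvw : v w = 0 := by simpa [hy] using hvN y
  have hzw : z w = 0 := by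
    rw [rk_mul_rk] at hNN
    exact (smul_eq_zero.mp hNN).resolve_right hne
  obtain ⟨e, hze, hve⟩ : ∃ e, z e = 1 ∧ v e = 0 :=
    ⟨y - v y • u, by simp [hy, hzu], by simp [hvu]⟩
  obtain ⟨k, hk⟩ := exists_dual_eq_one hw
  obtain ⟨p, hpw, hpu, hpe⟩ : ∃ p : StrongDual ℂ E, p w = 1 ∧ p u = 0 ∧ p e = 0 :=
    ⟨k - k u • v - k e • z, by simp [hk, hvw, hzw], by simp [hvu, hzu], by simp [hve, hze]⟩
  have h1 := h (rk u v + rk e p) ((frle_rk _ _).add (frle_rk _ _))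
  have h3 : LinearIndependent ℂ fun i =>
      (T * (rk u v + rk e p) + (rk u v + rk e p) * T) (![u, e, w] i) := by
    refine linearIndependent_of_det_ne_zero ![v, z, p] ?_
    rw [Matrix.det_fin_three]
    simp [hN, hvu, hve, hvw, hzu, hze, hzw, hpw, hpu, hpe, hc]
  exact absurd (h1.card_le h3) (by norm_num)

end SingleVariable

/-! ### Recovering `T ↦ f (T x)` from `φ`. -/

section Functionals

variable {E : Type*} [NormedAddCommGroup E] [NormedSpace ℂ E]

theorem frle_of_local {A : NonUnitalSubalgebra ℂ (E →L[ℂ] E)} (hA : IsStandard A) {φ : A → A}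
    {ε : ℂ} {d r s : ℕ} (hε : Admissible ε d) (hrs : r + s ≠ 0)
    (h : ∀ B X : A, FRLE 1 (B : E →L[ℂ] E) ∨ FRLE 1 (X : E →L[ℂ] E) →
      ∃ (θ : A ≃ₗ[ℂ] A) (M : A), IsJordanAut θ ∧ (M : E →L[ℂ] E) = sandwich ε r s B X ∧
        (θ M : E →L[ℂ] E) = sandwich ε r s (φ B) (φ X))
    {B X : A} (hBX : FRLE 1 (B : E →L[ℂ] E) ∨ FRLE 1 (X : E →L[ℂ] E)) :
    FRLE d (sandwich ε r s (φ B : E →L[ℂ] E) (φ X)) ∧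
      ftr (sandwich ε r s (φ B : E →L[ℂ] E) (φ X)) =
        ftr (sandwich ε r s (B : E →L[ℂ] E) X) := by
  obtain ⟨θ, M, hθ, hM, hφ⟩ := h B X hBX
  rw [← hφ, ← hM]
  exact hθ.map_frle hA (hM ▸ frle_sandwich hε hrs hBX)

theorem exists_functional {A : NonUnitalSubalgebra ℂ (E →L[ℂ] E)} (hA : IsStandard A) {φ : A → A}
    {ε : ℂ} {d r s : ℕ} (hε : Admissible ε d) (hrs : r + s ≠ 0)
    (hrange : ∀ T : E →L[ℂ] E, FRLE (d + 1) T → ∃ C : A, (φ C : E →L[ℂ] E) = T)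
    (h : ∀ B X : A, FRLE 1 (B : E →L[ℂ] E) ∨ FRLE 1 (X : E →L[ℂ] E) →
      ∃ (θ : A ≃ₗ[ℂ] A) (M : A), IsJordanAut θ ∧ (M : E →L[ℂ] E) = sandwich ε r s B X ∧
        (θ M : E →L[ℂ] E) = sandwich ε r s (φ B) (φ X))
    {x : E} {f : StrongDual ℂ E} (hf : f x = 1) :
    ∃ (a : E) (b : StrongDual ℂ E), b a ^ (r + s + 1) = 1 ∧
      ∀ T : A, b ((φ T : E →L[ℂ] E) a) = f ((T : E →L[ℂ] E) x) := by
  have hloc := fun B X => frle_of_local hA hε hrs h (B := B) (X := X)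
  have hε1 := hε.one_add_ne_zero
  have hidem : ∀ {u : E} {v : StrongDual ℂ E}, v u = 1 → rk u v * rk u v = rk u v := by
    intro u v huv
    rw [rk_mul_rk, huv, one_smul]
  have hpow : ∀ {u : E} {v : StrongDual ℂ E}, v u = 1 → ∀ {n : ℕ}, n ≠ 0 →
      rk u v ^ n = rk u v := by
    intro u v huv n hn
    obtain ⟨k, rfl⟩ := Nat.exists_eq_succ_of_ne_zero hn
    exact IsIdempotentElem.pow_succ_eq k (hidem huv)
  let B : A := ⟨rk x f, hA.mem (isFR_rk x f)⟩
  have hB : (B : E →L[ℂ] E) = rk x f := rfl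
  have hB1 : FRLE 1 (B : E →L[ℂ] E) := frle_rk x f
  obtain ⟨T, hT⟩ : ∃ T : E →L[ℂ] E, T = φ B := ⟨_, rfl⟩
  -- Here `B` is the isolated variable and the repeated one is a preimage of an idempotent of rank
  -- up to `d + 1`; this sets the rank demanded of the range of `φ`.
  have hTd : FRLE d T := by
    refine frle_of_sandwich (r := r) (s := s) hε fun R _ hR => ?_
    obtain ⟨C, rfl⟩ := hrange R hR
    rw [hT]
    exact (hloc C B (Or.inr hB1)).1
  obtain ⟨u, v, hTQ, hvu⟩ : ∃ u v, T ^ (r + s + 1) = rk u v ∧ v u = 1 := by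
    obtain ⟨θ, M, hθ, hM, hφ⟩ := h B B (Or.inl hB1)
    obtain ⟨u, v, huv, hvu⟩ := hθ.map_rk hA hB
    refine ⟨u, v, ?_, hvu.trans hf⟩
    rw [← hT, sandwich_eq_smul (Commute.refl _), ← pow_succ] at hφ
    rw [sandwich_eq_smul (Commute.refl _), ← pow_succ, hB, hpow hf (Nat.succ_ne_zero _)] at hM
    have hM' : M = (1 + ε) • B := Subtype.ext hM
    rw [hM', map_smul] at hφ
    rw [← huv]
    exact (smul_right_injective _ hε1 hφ).symm
  obtain ⟨c, hcm, hTu, hvT⟩ := root_of_idempotent hvu hTQ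
  have hc : c ≠ 0 := fun h0 => by simp [h0] at hcm
  have hTn : T ^ (r + s) = c ^ (r + s) • rk u v := by
    obtain ⟨N, hN⟩ : ∃ N, N = T - c • rk u v := ⟨_, rfl⟩
    have hTN : T = c • rk u v + N := by rw [hN]; abel
    have hNu : N u = 0 := by simp [hN, hTu, hvu]
    have hvN : ∀ y, v (N y) = 0 := fun y => by simp [hN, hvT, hvu]
    have hQN : rk u v * N = 0 := by ext y; simp [hvN]
    have hNQ : N * rk u v = 0 := by ext y; simp [hNu]
    have hsplit : ∀ {n : ℕ}, n ≠ 0 → (c • rk u v + N) ^ n = c ^ n • rk u v + N ^ n :=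
      pow_eq_of_orthogonal (hidem hvu) hQN hNQ c
    suffices hNn : N ^ (r + s) = 0 by
      rw [hTN, hsplit hrs, hNn, add_zero]
    rcases hε with ⟨rfl, rfl⟩ | ⟨rfl, rfl⟩
    · rw [hN, ← eq_smul_rk_of_frle_one hTd hvu hc hTu hvT, sub_self, zero_pow hrs]
    · have hN1 := frle_one_of_frle_two hTd hvu hc hTu hTN hvN
      have hNm : N ^ (r + s + 1) = 0 := by
        have := hsplit (Nat.succ_ne_zero (r + s))
        rw [← hTN, Nat.succ_eq_add_one, hTQ, hcm, one_smul] at this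
        exact left_eq_add.mp this
      -- A nilpotent operator of rank at most one squares to zero.
      have hNN : N * N = 0 := by
        obtain ⟨w, z, rfl⟩ := hN1.exists_rk
        have h1 : ∀ k : ℕ, rk w z ^ (k + 1) = z w ^ k • rk w z := by
          intro k
          induction k with
          | zero => simp
          | succ k ih => rw [pow_succ, ih, smul_mul_assoc, rk_mul_rk, smul_smul, ← pow_succ]
        rw [h1] at hNm
        rcases smul_eq_zero.mp hNm with h2 | h2
        · rw [rk_mul_rk, eq_zero_of_pow_eq_zero h2, zero_smul]
        · rw [h2, mul_zero]
      by_cases h1 : r + s = 1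
      · rw [h1, pow_one]
        refine eq_zero_of_jordan_frle_two hvu hc hTN hNu hvN hN1 hNN fun R hR => ?_
        obtain ⟨C, rfl⟩ := hrange R (hR.mono (by norm_num))
        have h2 := (hloc B C (Or.inl hB1)).1
        rw [← hT] at h2
        obtain ⟨rfl, rfl⟩ | ⟨rfl, rfl⟩ : (r = 0 ∧ s = 1) ∨ (r = 1 ∧ s = 0) := by omega
        · simpa [sandwich, add_comm] using h2
        · simpa [sandwich] using h2
      · obtain ⟨k, hk⟩ := Nat.exists_eq_add_of_le (show 2 ≤ r + s by omega)
        rw [hk, pow_add, pow_two, hNN, zero_mul]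
  -- The scalar of `T ^ (r + s) = c ^ (r + s) • rk u v` goes into the vector; the trace identity for
  -- the pair `B`, `Y` then reads off both functionals.
  refine ⟨c ^ (r + s) • u, v, ?_, fun Y => ?_⟩
  · rw [map_smul, hvu, smul_eq_mul, mul_one, ← pow_mul, mul_comm, pow_mul, hcm, one_pow]
  · have h1 := (hloc B Y (Or.inl hB1)).2
    rw [← hT, ftr_sandwich hrs hTd.isFR, ftr_sandwich hrs hB1.isFR, hB, hpow hf hrs, hTn,
      ← rk_smul_left, rk_mul, rk_mul, ftr_rk, ftr_rk] at h1
    exact mul_left_cancel₀ hε1 h1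

end Functionals

/-! ### Specializing the generalized products to two variables. -/

section Words

theorem prod_ofFn_ite {M : Type*} [Monoid M] (X B : M) : ∀ {m : ℕ} (p : Fin m),
    (List.ofFn fun j => if j = p then X else B).prod = B ^ (p : ℕ) * X * B ^ (m - 1 - p)
  | 0, p => p.elim0
  | m + 1, p => by
    rw [List.ofFn_succ, List.prod_cons]
    induction p using Fin.cases with
    | zero => simp [Fin.succ_ne_zero]
    | succ p =>
      have h1 := prod_ofFn_ite X B p
      have h2 : m + 1 - 1 - ((p : ℕ) + 1) = m - 1 - p := by omega
      simp only [Fin.succ_inj, h1, h2, Fin.val_succ, pow_succ', (Fin.succ_ne_zero p).symm,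
        if_false, mul_assoc]

end Words

section Reduction

variable {E : Type*} [NormedAddCommGroup E] [NormedSpace ℂ E]
  {A : NonUnitalSubalgebra ℂ (E →L[ℂ] E)} {m k : ℕ}

theorem coe_wordProd (hm : 0 < m) (T : Fin m → A) :
    (wordProd hm T : E →L[ℂ] E) = (List.ofFn fun j => (T j : E →L[ℂ] E)).prod := rfl

theorem IndexSeq.one_lt (s : IndexSeq m k) : 1 < m := by
  have := Fintype.card_le_of_surjective _ s.surj
  simp only [Fintype.card_fin] at this
  exact s.two_le.trans this

/-- The variables of a generalized product, equal to `X` at `i` and to `B` elsewhere. -/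
def twoVar (i : Fin k) (B X : A) : Fin k → A := fun j => if j = i then X else B

theorem exists_twoVar_frle (hk : 2 ≤ k) (i : Fin k) {B X : A}
    (h : FRLE 1 (B : E →L[ℂ] E) ∨ FRLE 1 (X : E →L[ℂ] E)) :
    ∃ j, RankLE 1 (twoVar i B X j : E →L[ℂ] E) := by
  rcases h with h | h
  · have : Nontrivial (Fin k) := Fin.nontrivial_iff_two_le.mpr hk
    obtain ⟨j, hj⟩ := exists_ne i
    exact ⟨j, by simpa [twoVar, hj] using h.rankLE⟩
  · exact ⟨i, by simpa [twoVar] using h.rankLE⟩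

/-- The permutation `σ` serves both the word (identity) and its reversal; the isolated letter moves
to position `σ.symm p`. -/
theorem coe_wordProd_twoVar (s : IndexSeq m k) {p : Fin m}
    (hp : ∀ q, q ≠ p → s.idx q ≠ s.idx p) (σ : Equiv.Perm (Fin m)) (B X : A) :
    (wordProd s.pos (fun j => twoVar (s.idx p) B X (s.idx (σ j))) : E →L[ℂ] E) =
      (B : E →L[ℂ] E) ^ (σ.symm p : ℕ) * X * (B : E →L[ℂ] E) ^ (m - 1 - (σ.symm p : ℕ)) := by
  rw [coe_wordProd, ← prod_ofFn_ite]
  congr 2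
  ext1 j
  have h1 : s.idx (σ j) = s.idx p ↔ j = σ.symm p := by
    rw [Equiv.eq_symm_apply]
    exact ⟨fun h => by_contra fun hne => hp _ hne h, fun h => by rw [h]⟩
  by_cases h2 : j = σ.symm p
  · rw [twoVar, if_pos (h1.mpr h2), if_pos h2]
  · rw [twoVar, if_neg (mt h1.mp h2), if_neg h2]

theorem coe_genProd_twoVar (s : IndexSeq m k) {p : Fin m}
    (hp : ∀ q, q ≠ p → s.idx q ≠ s.idx p) (B X : A) :
    (genProd s (twoVar (s.idx p) B X) : E →L[ℂ] E) = sandwich 0 p (m - 1 - p) B X := by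
  rw [sandwich, zero_smul, add_zero]
  exact coe_wordProd_twoVar s hp 1 B X

theorem coe_genJordanProd_twoVar (s : IndexSeq m k) {p : Fin m}
    (hp : ∀ q, q ≠ p → s.idx q ≠ s.idx p) (B X : A) :
    (genJordanProd s (twoVar (s.idx p) B X) : E →L[ℂ] E) = sandwich 1 p (m - 1 - p) B X := by
  have h1 := coe_wordProd_twoVar s hp 1 B X
  have h2 := coe_wordProd_twoVar s hp Fin.revPerm B X
  have h3 : ((Fin.revPerm.symm p : Fin m) : ℕ) = m - 1 - p := by
    rw [Fin.revPerm_symm, Fin.revPerm_apply, Fin.val_rev]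
    omega
  have h4 : m - 1 - (m - 1 - (p : ℕ)) = p := by omega
  rw [h3, h4] at h2
  rw [sandwich, one_smul]
  exact congrArg₂ (· + ·) h1 h2

/-- Abstracting the product as `P` treats both hypotheses at once: `d + 1` is 2 for the plain
product and 3 for the Jordan product. -/
theorem hasStandardForm_of_local [CompleteSpace E] (hA : IsStandard A) (s : IndexSeq m k)
    {φ : A → A} {ε : ℂ} {d : ℕ} (hε : Admissible ε d)
    (hrange : ∀ T : A, RankLE (d + 1) (T : E →L[ℂ] E) → T ∈ Set.range φ)
    (P : (Fin k → A) → A)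
    (hP : ∀ p : Fin m, (∀ q, q ≠ p → s.idx q ≠ s.idx p) → ∀ B X : A,
      (P (twoVar (s.idx p) B X) : E →L[ℂ] E) = sandwich ε p (m - 1 - p) B X)
    (h : ∀ a : Fin k → A, (∃ j, RankLE 1 (a j : E →L[ℂ] E)) →
      ∃ θ : A ≃ₗ[ℂ] A, IsJordanAut θ ∧ P (fun j => φ (a j)) = θ (P a)) :
    HasStandardForm m φ := by
  obtain ⟨p, hp⟩ := s.exists_single
  have hm := s.one_lt
  have hpm := p.isLt
  have hrange' : ∀ T : E →L[ℂ] E, FRLE (d + 1) T → ∃ C : A, (φ C : E →L[ℂ] E) = T := by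
    intro T hT
    obtain ⟨C, hC⟩ := hrange ⟨T, hA.mem hT.isFR⟩ hT.rankLE
    exact ⟨C, congrArg Subtype.val hC⟩
  refine hasStandardForm_of_functionals hA (by omega)
    (fun y g => hrange' _ ((frle_rk y g).mono (by omega))) fun x f hf => ?_
  have hsum : (p : ℕ) + (m - 1 - p) + 1 = m := by omega
  have h0 : (p : ℕ) + (m - 1 - p) ≠ 0 := by omega
  have := exists_functional hA hε h0 hrange' (φ := φ) (fun B X hBX => ?_) hf
  · rwa [hsum] at this
  obtain ⟨θ, hθ, h1⟩ := h _ (exists_twoVar_frle s.two_le (s.idx p) hBX)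
  refine ⟨θ, _, hθ, hP p hp B X, ?_⟩
  rw [← h1, ← hP p hp]
  congr 2
  ext1 j
  exact apply_ite φ _ _ _

end Reduction

end OpProd

theorem theorem2p4 {E : Type*} [NormedAddCommGroup E] [NormedSpace ℂ E] [CompleteSpace E]
    (A : NonUnitalSubalgebra ℂ (E →L[ℂ] E)) (hA : OpProd.IsStandard A)
    {m k : ℕ} (s : OpProd.IndexSeq m k) (φ : A → A) :
    ((∀ T : A, OpProd.RankLE 2 (T : E →L[ℂ] E) → T ∈ Set.range φ) →
      (∀ a : Fin k → A, (∃ j, OpProd.RankLE 1 (a j : E →L[ℂ] E)) →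
        ∃ θ : A ≃ₗ[ℂ] A, OpProd.IsAlgAut θ ∧
          OpProd.genProd s (fun j => φ (a j)) = θ (OpProd.genProd s a)) →
      OpProd.HasStandardForm m φ) ∧
    ((∀ T : A, OpProd.RankLE 3 (T : E →L[ℂ] E) → T ∈ Set.range φ) →
      (∀ a : Fin k → A, (∃ j, OpProd.RankLE 1 (a j : E →L[ℂ] E)) →
        ∃ θ : A ≃ₗ[ℂ] A, OpProd.IsJordanAut θ ∧
          OpProd.genJordanProd s (fun j => φ (a j)) = θ (OpProd.genJordanProd s a)) →
      OpProd.HasStandardForm m φ) := by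
  refine ⟨fun hrange h => ?_, fun hrange h => ?_⟩
  · refine OpProd.hasStandardForm_of_local hA s (Or.inl ⟨rfl, rfl⟩) hrange (OpProd.genProd s)
      (fun p hp B X => OpProd.coe_genProd_twoVar s hp B X) fun a ha => ?_
    obtain ⟨θ, hθ, h1⟩ := h a ha
    exact ⟨θ, hθ.isJordanAut, h1⟩
  · exact OpProd.hasStandardForm_of_local hA s (Or.inr ⟨rfl, rfl⟩) hrange (OpProd.genJordanProd s)
      (fun p hp B X => OpProd.coe_genJordanProd_twoVar s hp B X) h
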